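/- **Lemma.** Let $n\ge 1$, and let $K\subset\mathbb R^{n+1}$ be a smooth, strictly convex body (a compact convex set with non-empty interior whose boundary is a $C^\infty$ hypersurface with positive definite second fundamental form) containing the origin in its interior. Let $h(x)=\max_{y\in K}\langle x,y\rangle$, $x\in\mathbb S^n$, be its support function, let $\theta$ be the spherical Lebesgue measure on $\mathbb S^n$, and let $\bar g$ and $\bar\nabla$ be the round metric of $\mathbb S^n$ and its Levi-Civita connection. Let $\mathcal K$ be the Gauss curvature, as a function of the outer unit normal, so that $1/\mathcal K=\det(\bar\nabla^2h+h\bar g)/\det\bar g$. Put $$dV=\frac{h}{\mathcal K}\,d\theta,\qquad X(x)=\bar\nabla h(x)+h(x)x,\qquad c=c(K)=\frac{\int_{\mathbb S^n} X\,dV}{\int_{\mathbb S^n} dV},$$ and let $\tilde h(x)=h(x)-\langle x,c\rangle$ be the support function of $K-c$. If $dV=h^p\,d\theta$ for some real number $p>-n-1$, then $$\int_{\mathbb S^n}|\bar\nabla h|^2\,dV=\int_{\mathbb S^n}|\bar\nabla\tilde h|^2\,dV+\frac{n(n+1-p)\,|c|^2}{(n+1)(n+1+p)}\int_{\mathbb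 S^n}dV .$$ -/

import Mathlib

open MeasureTheory Metric
open scoped RealInnerProductSpace ContDiff

noncomputable section

/-- The Euclidean space of dimension `n + 1`. -/
abbrev Euc (n : ℕ) : Type := EuclideanSpace ℝ (Fin (n + 1))

/-- The unit sphere of dimension `n` in `Euc n`. -/
abbrev Sph (n : ℕ) : Type := sphere (0 : Euc n) 1

/-- Spherical Lebesgue measure (surface measure) on the unit sphere. -/
def sphMeasure (n : ℕ) : Measure (Sph n) := (volume : Measure (Euc n)).toSphere

/-- A compact convex set with non-empty interior, whose boundary is a smooth hypersurface with
everywhere positive definite second fundamental form: near each boundary point `q` the set is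
`{ρ ≤ 0}` for a smooth function `ρ` with `Dρ(q) ≠ 0`, and `D²ρ(q)` is positive definite on the
tangent space `ker Dρ(q)` of the boundary at `q`. -/
structure IsSmoothStrictlyConvexBody {n : ℕ} (K : Set (Euc n)) : Prop where
  isCompact : IsCompact K
  convex : Convex ℝ K
  interior_nonempty : (interior K).Nonempty
  boundary : ∀ q ∈ frontier K, ∃ (U : Set (Euc n)) (ρ : Euc n → ℝ),
    IsOpen U ∧ q ∈ U ∧ ContDiffOn ℝ ∞ ρ U ∧ K ∩ U = {y | y ∈ U ∧ ρ y ≤ 0} ∧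
    fderiv ℝ ρ q ≠ 0 ∧
    ∀ v : Euc n, v ≠ 0 → fderiv ℝ ρ q v = 0 → 0 < fderiv ℝ (fderiv ℝ ρ) q v v

/-- The support function `h_K(x) = max {⟨x, y⟩ : y ∈ K}`. -/
def supportFun {n : ℕ} (K : Set (Euc n)) (x : Euc n) : ℝ :=
  sSup ((fun y => ⟪x, y⟫) '' K)

/-- The extension of `f` from the unit sphere to the punctured space that is constant on rays;
it depends on the values of `f` on the sphere only (the value at the origin is irrelevant). -/
def radialExt {n : ℕ} (f : Euc n → ℝ) (y : Euc n) : ℝ := f (‖y‖⁻¹ • y)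

/-- The gradient, for the round metric, of the restriction of `f` to the unit sphere, as a vector
of the ambient space: the Euclidean gradient of the extension that is constant on rays. -/
def sphGrad {n : ℕ} (f : Euc n → ℝ) (x : Euc n) : Euc n := gradient (radialExt f) x

/-- The Hessian, for the round metric, of the restriction of `f` to the unit sphere, as an
endomorphism of the tangent space at `x`, which is the orthogonal complement of `x`. It is the
covariant derivative of the gradient field: differentiate in the ambient space, then project
orthogonally to the tangent space. -/
def sphHess {n : ℕ} (f : Euc n → ℝ) (x : Euc n) :
    ((ℝ ∙ x)ᗮ : Submodule ℝ (Euc n)) →L[ℝ] ((ℝ ∙ x)ᗮ : Submodule ℝ (Euc n)) :=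
  ((ℝ ∙ x)ᗮ).orthogonalProjectionOnto ∘L fderiv ℝ (sphGrad f) x ∘L ((ℝ ∙ x)ᗮ).subtypeL

/-- The Gauss curvature of `K` as a function of the outward unit normal `x`; its inverse is the
determinant of `∇²h + h g` relative to `g`, where `g` is the round metric. -/
def gaussCurv {n : ℕ} (K : Set (Euc n)) (x : Euc n) : ℝ :=
  (LinearMap.det (sphHess (supportFun K) x +
    supportFun K x • ContinuousLinearMap.id ℝ ((ℝ ∙ x)ᗮ : Submodule ℝ (Euc n)) :
      ((ℝ ∙ x)ᗮ : Submodule ℝ (Euc n)) →ₗ[ℝ] ((ℝ ∙ x)ᗮ : Submodule ℝ (Euc n))))⁻¹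

/-- The measure `V_K` with `dV_K = (h_K / 𝒦_K) dθ`, which is `n + 1` times the cone-volume
measure. -/
def coneMeasure {n : ℕ} (K : Set (Euc n)) : Measure (Sph n) :=
  (sphMeasure n).withDensity
    (fun x => ENNReal.ofReal (supportFun K (x : Euc n) / gaussCurv K (x : Euc n)))

/-- The inverse Gauss map `X = Dh = ∇h + h x`. -/
def invGaussMap {n : ℕ} (K : Set (Euc n)) (x : Euc n) : Euc n :=
  sphGrad (supportFun K) x + supportFun K x • x

/-- The point `c(K) = ∫ X dV / ∫ dV`. -/
def coneCenter {n : ℕ} (K : Set (Euc n)) : Euc n :=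
  (∫ _x : Sph n, (1 : ℝ) ∂(coneMeasure K))⁻¹ •
    ∫ x : Sph n, invGaussMap K (x : Euc n) ∂(coneMeasure K)

/-- The translated body `K - c(K)`. -/
def centeredBody {n : ℕ} (K : Set (Euc n)) : Set (Euc n) :=
  (fun y => y - coneCenter K) '' K

end

/-! On the unit sphere `X` is the Euclidean gradient of `h`, and translating by `c` replaces `X` by
`X - c` and `h` by `h - ⟨x,c⟩`. Comparing the squared lengths of tangential parts gives, pointwise,
`|∇h|² - |∇h̃|² = 2⟨X,c⟩ - |c|² + ⟨x,c⟩² - 2h⟨x,c⟩` (`norm_sq_sphGrad`). With `V = ∫ dV`, the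
definition of `c` gives `∫⟨X,c⟩ dV = |c|² V`, so only `Q = ∫ h⟨x,c⟩ dV` and `I = ∫ ⟨x,c⟩² dV`
remain.

For `F` homogeneous of degree `d`, the divergence theorem on the sphere reads `∫ ∂_e F dθ = (n + d)
∫ F⟨x,e⟩ dθ` (`integral_fderiv_sphere_of_homogeneous`). When `dV = h^p dθ`, the choice `F = h^(p+1)`
yields `(p+1)|c|² V = (n+1+p) Q`, and `F = h^p⟨y,c⟩` yields `p S + |c|² V = (n+1+p) I`, where `S = ∫
⟨x,c⟩⟨X,c⟩/h dV`.

The integral `S` is found without using the power density. In boundary terms `S` is the flux through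
`∂K` of `z ↦ ⟨z,c⟩c`, whose divergence is `|c|²`; as `V = (n+1) vol K`, this says `(n+1) S = |c|²
V`. The proof obtains it as a first variation of volume. The map `coneMap`, `r x ↦ r X(x)`, carries
the unit ball onto `K`, with Jacobian `h/𝒦` on the sphere, so volumes become spherical integrals of
`dV`. The preimage of `K` under `z ↦ z + t⟨c,z⟩c` has explicit volume and lies in the image of an
explicit star-shaped region; the resulting inequality is an equality at `t = 0`, so the two
derivatives agree there (`integral_coneDensity_mul_stretchRate`).

All of this needs `h` to be smooth away from the origin, which follows from the definition of the
body by the inverse function theorem (`contDiffAt_supportFun_of_boundary`). -/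

open Filter Topology
open scoped Pointwise

/-! ### Support functions of compact sets. -/

section SupportFunction

variable {n : ℕ} {K : Set (Euc n)}

theorem bddAbove_inner_image (hK : IsCompact K) (x : Euc n) :
    BddAbove ((fun y => ⟪x, y⟫) '' K) :=
  (hK.image (by fun_prop)).bddAbove

theorem inner_le_supportFun (hK : IsCompact K) (x : Euc n) {k : Euc n} (hk : k ∈ K) :
    ⟪x, k⟫ ≤ supportFun K x :=
  le_csSup (bddAbove_inner_image hK x) ⟨k, hk, rfl⟩

theorem supportFun_eq_of_forall_le {x q : Euc n} (hq : q ∈ K)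
    (h : ∀ k ∈ K, ⟪x, k⟫ ≤ ⟪x, q⟫) : supportFun K x = ⟪x, q⟫ := by
  refine le_antisymm (csSup_le ⟨_, q, hq, rfl⟩ ?_) (le_csSup ⟨⟪x, q⟫, ?_⟩ ⟨q, hq, rfl⟩)
  · rintro _ ⟨k, hk, rfl⟩; exact h k hk
  · rintro _ ⟨k, hk, rfl⟩; exact h k hk

theorem exists_supportFun_eq (hK : IsCompact K) (hne : K.Nonempty) (x : Euc n) :
    ∃ q ∈ K, supportFun K x = ⟪x, q⟫ := by
  obtain ⟨q, hq, h⟩ := hK.exists_isMaxOn hne (f := fun y => ⟪x, y⟫) (by fun_prop)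
  exact ⟨q, hq, supportFun_eq_of_forall_le hq fun k hk => h hk⟩

theorem exists_pos_add_smul_mem {q : Euc n} (hq : q ∈ interior K) (x : Euc n) :
    ∃ ε : ℝ, 0 < ε ∧ q + ε • x ∈ K := by
  have hc : Tendsto (fun ε : ℝ => q + ε • x) (𝓝[>] 0) (𝓝 q) := by
    have : ContinuousAt (fun ε : ℝ => q + ε • x) 0 := by fun_prop
    simpa using this.tendsto.mono_left nhdsWithin_le_nhds
  obtain ⟨ε, h1, h2⟩ := ((hc.eventually (mem_interior_iff_mem_nhds.1 hq)).and
    self_mem_nhdsWithin).exists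
  exact ⟨ε, h2, h1⟩

theorem supportFun_pos (hK : IsCompact K) (h0 : (0 : Euc n) ∈ interior K) {x : Euc n}
    (hx : x ≠ 0) : 0 < supportFun K x := by
  obtain ⟨ε, hε, h⟩ := exists_pos_add_smul_mem h0 x
  refine lt_of_lt_of_le ?_ (inner_le_supportFun hK x h)
  rw [zero_add, real_inner_smul_right, real_inner_self_eq_norm_sq]
  have := norm_pos_iff.2 hx
  positivity

theorem mem_frontier_of_supportFun_eq (hK : IsCompact K) {x q : Euc n} (hx : x ≠ 0) (hq : q ∈ K)
    (h : supportFun K x = ⟪x, q⟫) : q ∈ frontier K := by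
  refine ⟨subset_closure hq, fun hi => ?_⟩
  obtain ⟨ε, hε, hm⟩ := exists_pos_add_smul_mem hi x
  have h1 := inner_le_supportFun hK x hm
  rw [h, inner_add_right, real_inner_smul_right, real_inner_self_eq_norm_sq] at h1
  have := norm_pos_iff.2 hx
  have : 0 < ε * ‖x‖ ^ 2 := by positivity
  linarith

theorem supportFun_smul {t : ℝ} (ht : 0 ≤ t) (x : Euc n) :
    supportFun K (t • x) = t * supportFun K x := by
  have : (fun y : Euc n => ⟪t • x, y⟫) '' K = t • ((fun y : Euc n => ⟪x, y⟫) '' K) := by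
    rw [← Set.image_smul, Set.image_image]
    simp [real_inner_smul_left]
  rw [supportFun, this, Real.sSup_smul_of_nonneg ht]
  rfl

/-- The function `y ↦ h(y) - ⟨y,q⟩` is nonnegative and vanishes at `x`, so its derivative vanishes
there. -/
theorem gradient_supportFun_eq (hK : IsCompact K) {x q : Euc n} (hq : q ∈ K)
    (h : supportFun K x = ⟪x, q⟫) (hd : DifferentiableAt ℝ (supportFun K) x) :
    gradient (supportFun K) x = q := by
  have hmin : IsLocalMin (fun y => supportFun K y - ⟪y, q⟫) x := by
    refine Eventually.of_forall fun y => ?_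
    have := inner_le_supportFun hK y hq
    simp only [h]
    linarith
  have h1 : HasFDerivAt (fun y : Euc n => ⟪y, q⟫) (innerSL ℝ q) x := by
    convert (innerSL ℝ q).hasFDerivAt (x := x) using 1
    ext y; simp [real_inner_comm]
  have h2 := hmin.hasFDerivAt_eq_zero (hd.hasFDerivAt.sub h1)
  rw [sub_eq_zero] at h2
  rw [gradient, h2]
  exact (InnerProductSpace.toDual ℝ (Euc n)).symm_apply_apply q

end SupportFunction

/-! ### Local defining functions, normals, and smoothness of the support function. -/

section Boundary

variable {n : ℕ} {K U : Set (Euc n)} {ρ : Euc n → ℝ} {q : Euc n}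

theorem fderiv_sub_nonpos_of_convex (hK : Convex ℝ K) (hU : IsOpen U) (hqU : q ∈ U)
    (hKU : K ∩ U = {y | y ∈ U ∧ ρ y ≤ 0}) (hd : DifferentiableAt ℝ ρ q) (hq0 : ρ q = 0)
    {k : Euc n} (hk : k ∈ K) : fderiv ℝ ρ q (k - q) ≤ 0 := by
  have hqK : q ∈ K := by
    have : q ∈ K ∩ U := by rw [hKU]; exact ⟨hqU, hq0.le⟩
    exact this.1
  have hloc : IsLocalMaxOn ρ K q := by
    filter_upwards [mem_nhdsWithin_of_mem_nhds (hU.mem_nhds hqU), self_mem_nhdsWithin] with y hy hyK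
    have : y ∈ K ∩ U := ⟨hyK, hy⟩
    rw [hKU] at this
    rw [hq0]; exact this.2
  exact hloc.hasFDerivWithinAt_nonpos hd.hasFDerivAt.hasFDerivWithinAt
    (sub_mem_posTangentConeAt_of_segment_subset (hK.segment_subset hqK hk))

theorem eq_zero_of_mem_frontier (hK : IsClosed K) (hU : IsOpen U) (hqU : q ∈ U)
    (hKU : K ∩ U = {y | y ∈ U ∧ ρ y ≤ 0}) (hc : ContinuousAt ρ q) (hq : q ∈ frontier K) :
    ρ q = 0 := by
  have h1 : q ∈ K ∩ U := ⟨hK.frontier_subset hq, hqU⟩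
  rw [hKU] at h1
  refine le_antisymm h1.2 (not_lt.1 fun hlt => hq.2 ?_)
  rw [mem_interior_iff_mem_nhds]
  filter_upwards [hU.mem_nhds hqU, hc.eventually_lt_const hlt] with y hy1 hy2
  have : y ∈ K ∩ U := by rw [hKU]; exact ⟨hy1, hy2.le⟩
  exact this.1

/-- A direction along which `ρ` strictly decreases enters `K`, and `⟪x, ·⟫` cannot grow on `K` from
its maximum point `q`. -/
theorem inner_nonpos_of_fderiv_neg (hU : IsOpen U) (hqU : q ∈ U)
    (hKU : K ∩ U = {y | y ∈ U ∧ ρ y ≤ 0}) (hd : DifferentiableAt ℝ ρ q) (hq0 : ρ q = 0)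
    {x : Euc n} (hx : ∀ k ∈ K, ⟪x, k⟫ ≤ ⟪x, q⟫) {v : Euc n} (hv : fderiv ℝ ρ q v < 0) :
    ⟪x, v⟫ ≤ 0 := by
  have hline : HasDerivAt (fun t : ℝ => q + t • v) v 0 := by
    simpa using ((hasDerivAt_id (0 : ℝ)).smul_const v).const_add q
  have hder : HasDerivAt (fun t : ℝ => ρ (q + t • v)) (fderiv ℝ ρ q v) 0 := by
    have hd' : HasFDerivAt ρ (fderiv ℝ ρ q) (q + (0 : ℝ) • v) := by simpa using hd.hasFDerivAt
    exact hd'.comp_hasDerivAt (0 : ℝ) hline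
  have hs := (hasDerivWithinAt_iff_tendsto_slope' (s := Set.Ioi (0 : ℝ)) (by simp)).1
    hder.hasDerivWithinAt
  have hU' : ∀ᶠ t : ℝ in 𝓝[>] 0, q + t • v ∈ U := by
    refine nhdsWithin_le_nhds (hline.continuousAt.eventually_mem ?_)
    simpa using hU.mem_nhds hqU
  obtain ⟨t, ⟨h1, h2⟩, (h3 : 0 < t)⟩ :=
    (((hs.eventually_lt_const hv).and hU').and self_mem_nhdsWithin).exists
  have h4 : ρ (q + t • v) ≤ 0 := by
    simp only [slope_def_field, zero_smul, add_zero, hq0, sub_zero] at h1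
    by_contra hcon
    exact absurd h1 (not_lt.2 (div_nonneg (not_le.1 hcon).le h3.le))
  have h5 : q + t • v ∈ K ∩ U := by rw [hKU]; exact ⟨h2, h4⟩
  have h6 := hx _ h5.1
  rw [inner_add_right, real_inner_smul_right] at h6
  by_contra hcon
  have := mul_pos h3 (not_le.1 hcon)
  linarith

theorem inner_gradient_eq_fderiv (f : Euc n → ℝ) (y v : Euc n) :
    ⟪gradient f y, v⟫ = fderiv ℝ f y v := by
  rw [gradient, InnerProductSpace.toDual_symm_apply]

/-- Lagrange multipliers with one inequality constraint: the open half-space `⟪g, ·⟫ < 0` lies in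
`⟪x, ·⟫ ≤ 0`, which forces `x` onto the ray of `g`. -/
theorem exists_smul_gradient_eq_normal (hU : IsOpen U) (hqU : q ∈ U)
    (hKU : K ∩ U = {y | y ∈ U ∧ ρ y ≤ 0}) (hd : DifferentiableAt ℝ ρ q) (hq0 : ρ q = 0)
    (hne : fderiv ℝ ρ q ≠ 0) {x : Euc n} (hx : ∀ k ∈ K, ⟪x, k⟫ ≤ ⟪x, q⟫) :
    ∃ l : ℝ, 0 ≤ l ∧ x = l • gradient ρ q := by
  set g := gradient ρ q with hg
  have hg0 : g ≠ 0 := by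
    intro h
    apply hne
    ext v
    rw [← inner_gradient_eq_fderiv, ← hg, h]; simp
  have hgn : 0 < ‖g‖ ^ 2 := by have := norm_pos_iff.2 hg0; positivity
  have key : ∀ v, ⟪g, v⟫ < 0 → ⟪x, v⟫ ≤ 0 := fun v hv =>
    inner_nonpos_of_fderiv_neg hU hqU hKU hd hq0 hx (by rwa [← inner_gradient_eq_fderiv])
  have hxg : 0 ≤ ⟪x, g⟫ := by
    have := key (-g) (by rw [inner_neg_right, real_inner_self_eq_norm_sq]; linarith)
    rw [inner_neg_right] at this; linarith
  set l := ⟪x, g⟫ / ‖g‖ ^ 2 with hl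
  refine ⟨l, div_nonneg hxg hgn.le, ?_⟩
  set w := x - l • g with hw
  have hlg : l * ‖g‖ ^ 2 = ⟪x, g⟫ := by rw [hl]; field_simp
  have hgw : ⟪g, w⟫ = 0 := by
    rw [hw, inner_sub_right, real_inner_smul_right, real_inner_self_eq_norm_sq, hlg,
      real_inner_comm, sub_self]
  have hxw : ⟪x, w⟫ = ‖w‖ ^ 2 := by
    rw [← real_inner_self_eq_norm_sq]
    nth_rewrite 2 [hw]
    rw [inner_sub_left, real_inner_smul_left, hgw]; ring
  -- The residual `w` is orthogonal to `g`, so it is only on the edge of the half-space; tilting it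
  -- by `-ε g` makes it admissible, and `ε → 0` gives `w = 0`.
  have hle : ∀ ε : ℝ, 0 < ε → ‖w‖ ^ 2 ≤ ε * ⟪x, g⟫ := by
    intro ε hε
    have := key (w - ε • g) (by
      rw [inner_sub_right, real_inner_smul_right, real_inner_self_eq_norm_sq, hgw]
      have := mul_pos hε hgn
      linarith)
    rw [inner_sub_right, real_inner_smul_right, hxw] at this
    linarith
  have hw0 : ‖w‖ ^ 2 ≤ 0 := by
    have ht : Tendsto (fun ε : ℝ => ε * ⟪x, g⟫) (𝓝[>] 0) (𝓝 0) := by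
      have : ContinuousAt (fun ε : ℝ => ε * ⟪x, g⟫) 0 := by fun_prop
      simpa using this.tendsto.mono_left nhdsWithin_le_nhds
    exact ge_of_tendsto ht (eventually_mem_nhdsWithin.mono fun ε hε => hle ε hε)
  have : w = 0 := by
    rw [← norm_eq_zero]
    exact pow_eq_zero_iff (two_ne_zero) |>.1 (le_antisymm hw0 (by positivity))
  exact sub_eq_zero.1 this

theorem contDiffOn_gradient (hU : IsOpen U) (hρ : ContDiffOn ℝ ∞ ρ U) :
    ContDiffOn ℝ ∞ (gradient ρ) U :=
  (InnerProductSpace.toDual ℝ (Euc n)).symm.contDiff.comp_contDiffOn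
    (hρ.fderiv_of_isOpen hU (by simp))

theorem inner_fderiv_gradient {f : Euc n → ℝ} {y : Euc n}
    (hf : DifferentiableAt ℝ (fderiv ℝ f) y) (hg : DifferentiableAt ℝ (gradient f) y)
    (v w : Euc n) : ⟪fderiv ℝ (gradient f) y v, w⟫ = fderiv ℝ (fderiv ℝ f) y v w := by
  have h1 : HasFDerivAt (fun z => ⟪gradient f z, w⟫)
      ((innerSL ℝ w) ∘L fderiv ℝ (gradient f) y) y := by
    have := (innerSL ℝ w).hasFDerivAt.comp y hg.hasFDerivAt
    refine this.congr_of_eventuallyEq (Eventually.of_forall fun z => ?_)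
    simp
  have h2 : HasFDerivAt (fun z => fderiv ℝ f z w) ((fderiv ℝ (fderiv ℝ f) y).flip w) y := by
    simpa using hf.hasFDerivAt.clm_apply (hasFDerivAt_const w y)
  simp only [inner_gradient_eq_fderiv] at h1
  have := DFunLike.congr_fun (h1.unique h2) v
  simpa [real_inner_comm] using this

/-- The point of `K` with outer normal `x`, together with the multiplier, solves `s ∇ρ(y) = x`,
`ρ(y) = 0`. Positivity of `D²ρ` on the tangent space makes this system nondegenerate, so the
solution `y` is a smooth function of `x`, and `h(x) = ⟪x, y⟫`. -/
theorem contDiffAt_supportFun_of_boundary (hKc : Convex ℝ K)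
    (hU : IsOpen U) (hqU : q ∈ U) (hρ : ContDiffOn ℝ ∞ ρ U)
    (hKU : K ∩ U = {y | y ∈ U ∧ ρ y ≤ 0}) (hne : fderiv ℝ ρ q ≠ 0)
    (hpos : ∀ v : Euc n, v ≠ 0 → fderiv ℝ ρ q v = 0 → 0 < fderiv ℝ (fderiv ℝ ρ) q v v)
    (hq0 : ρ q = 0) {m : ℝ} (hm : 0 < m) :
    ContDiffAt ℝ ∞ (supportFun K) (m • gradient ρ q) := by
  set g := gradient ρ q with hg
  have hdiff : ∀ y ∈ U, DifferentiableAt ℝ ρ y := fun y hy =>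
    (hρ.contDiffAt (hU.mem_nhds hy)).differentiableAt (by simp)
  have hG := contDiffOn_gradient hU hρ
  have hGq : ContDiffAt ℝ ∞ (gradient ρ) q := hG.contDiffAt (hU.mem_nhds hqU)
  have hρq : ContDiffAt ℝ ∞ ρ q := hρ.contDiffAt (hU.mem_nhds hqU)
  let F : Euc n × ℝ → Euc n × ℝ := fun z => (z.2 • gradient ρ z.1, ρ z.1)
  have hF : ContDiffAt ℝ ∞ F (q, m) := by
    refine ContDiffAt.prodMk (contDiffAt_snd.smul ?_) ?_
    · exact ContDiffAt.comp (q, m) (f := Prod.fst) (g := gradient ρ) hGq contDiffAt_fst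
    · exact ContDiffAt.comp (q, m) (f := Prod.fst) (g := ρ) hρq contDiffAt_fst
  have hfd2 : DifferentiableAt ℝ (fderiv ℝ ρ) q :=
    (hρq.fderiv_right (m := ∞) (by simp)).differentiableAt (by simp)
  have hinj : Function.Injective (fderiv ℝ F (q, m)) := by
    have hder : HasFDerivAt F
        ((m • (fderiv ℝ (gradient ρ) q ∘L ContinuousLinearMap.fst ℝ (Euc n) ℝ) +
          (ContinuousLinearMap.snd ℝ (Euc n) ℝ).smulRight g).prod
          (fderiv ℝ ρ q ∘L ContinuousLinearMap.fst ℝ (Euc n) ℝ)) (q, m) := by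
      refine HasFDerivAt.prodMk ?_ ?_
      · have h1 : HasFDerivAt (fun z : Euc n × ℝ => gradient ρ z.1)
            (fderiv ℝ (gradient ρ) q ∘L ContinuousLinearMap.fst ℝ (Euc n) ℝ) (q, m) :=
          HasFDerivAt.comp (f := Prod.fst) (g := gradient ρ) (q, m)
            (hGq.differentiableAt (by simp)).hasFDerivAt hasFDerivAt_fst
        exact hasFDerivAt_snd.smul h1
      · exact HasFDerivAt.comp (f := Prod.fst) (g := ρ) (q, m)
          (hρq.differentiableAt (by simp)).hasFDerivAt hasFDerivAt_fst
    rw [hder.fderiv, injective_iff_map_eq_zero]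
    rintro ⟨v, s⟩ hvs
    simp only [ContinuousLinearMap.prod_apply, add_apply,
      smul_apply, ContinuousLinearMap.comp_apply, Prod.mk_eq_zero,
      ContinuousLinearMap.smulRight_apply, ContinuousLinearMap.coe_fst',
      ContinuousLinearMap.coe_snd'] at hvs
    obtain ⟨h1, h2⟩ := hvs
    have hgv : ⟪g, v⟫ = 0 := by rw [hg, inner_gradient_eq_fderiv, h2]
    -- Pairing the first equation with the tangent vector `v` removes the multiplier term `s • g`.
    have h3 : m * fderiv ℝ (fderiv ℝ ρ) q v v = 0 := by
      have := congrArg (fun u => ⟪u, v⟫) h1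
      simpa [inner_add_left, real_inner_smul_left, hgv, inner_fderiv_gradient hfd2 (hGq.differentiableAt (by simp))] using this
    have hv : v = 0 := by
      by_contra hv
      have := mul_pos hm (hpos v hv h2)
      linarith
    have hg0 : g ≠ 0 := by
      intro h
      apply hne
      ext v
      rw [← inner_gradient_eq_fderiv, ← hg, h]; simp
    subst hv
    simpa [hg0] using h1
  let L : (Euc n × ℝ) ≃L[ℝ] (Euc n × ℝ) :=
    (LinearEquiv.ofInjectiveEndo (fderiv ℝ F (q, m) : Euc n × ℝ →ₗ[ℝ] Euc n × ℝ)
      hinj).toContinuousLinearEquiv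
  have hL : HasFDerivAt F (L : Euc n × ℝ →L[ℝ] Euc n × ℝ) (q, m) :=
    (hF.differentiableAt (by simp)).hasFDerivAt
  have hn : (∞ : WithTop ℕ∞) ≠ 0 := by simp
  let Θ := hF.localInverse hL hn
  have hΘ : ContDiffAt ℝ ∞ Θ (F (q, m)) := hF.to_localInverse hL hn
  have hΘ0 : Θ (F (q, m)) = (q, m) := hF.localInverse_apply_image hL hn
  have hΘr : ∀ᶠ w in 𝓝 (F (q, m)), F (Θ w) = w :=
    (hF.hasStrictFDerivAt' hL hn).eventually_right_inverse
  have hFq : F (q, m) = (m • g, 0) := by simp [F, hq0, hg]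
  rw [hFq] at hΘ hΘ0 hΘr
  -- Second coordinate `0`: the local inverse is restricted to the level `ρ = 0`.
  let ι : Euc n → Euc n × ℝ := fun x => (x, 0)
  have hι : ContDiff ℝ ∞ ι := contDiff_id.prodMk contDiff_const
  let Z : Euc n → Euc n × ℝ := fun x => Θ (ι x)
  have hZ : ContDiffAt ℝ ∞ Z (m • g) :=
    ContDiffAt.comp (m • g) (f := ι) (g := Θ) hΘ hι.contDiffAt
  have hZ0 : Z (m • g) = (q, m) := hΘ0
  have hZr : ∀ᶠ x in 𝓝 (m • g), F (Z x) = ι x :=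
    (hι.continuous.tendsto (m • g)).eventually hΘr
  have hZU : ∀ᶠ x in 𝓝 (m • g), (Z x).1 ∈ U ∧ 0 < (Z x).2 := by
    have h1 : ∀ᶠ z in 𝓝 (q, m), z.1 ∈ U ∧ 0 < z.2 :=
      (continuousAt_fst.eventually (hU.mem_nhds hqU)).and
        (continuousAt_snd.eventually (lt_mem_nhds hm))
    have := hZ.continuousAt.tendsto
    rw [hZ0] at this
    exact this.eventually h1
  have hev : supportFun K =ᶠ[𝓝 (m • g)] fun x => ⟪x, (Z x).1⟫ := by
    filter_upwards [hZr, hZU] with x hx ⟨hxU, hxpos⟩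
    obtain ⟨hx1, hx2⟩ := Prod.ext_iff.1 hx
    simp only [F, ι] at hx1 hx2
    have hmem : (Z x).1 ∈ K := by
      have : (Z x).1 ∈ K ∩ U := by rw [hKU]; exact ⟨hxU, hx2.le⟩
      exact this.1
    -- By convexity the first-order condition at `(Z x).1` already gives a global maximum over `K`.
    refine supportFun_eq_of_forall_le hmem fun k hk => ?_
    have h1 := fderiv_sub_nonpos_of_convex hKc hU hxU hKU (hdiff _ hxU) hx2 hk
    rw [← inner_gradient_eq_fderiv] at h1
    have h2 : ⟪x, k - (Z x).1⟫ ≤ 0 := by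
      nth_rewrite 1 [← hx1]
      rw [real_inner_smul_left]
      exact mul_nonpos_of_nonneg_of_nonpos hxpos.le h1
    rw [inner_sub_right] at h2
    linarith
  refine ContDiffAt.congr_of_eventuallyEq ?_ hev
  exact contDiffAt_id.inner ℝ hZ.fst

end Boundary

/-! ### The gradient of the support function as the inverse Gauss map. -/

namespace IsSmoothStrictlyConvexBody

variable {n : ℕ} {K : Set (Euc n)}

theorem nonempty (hK : IsSmoothStrictlyConvexBody K) : K.Nonempty :=
  hK.interior_nonempty.mono interior_subset

theorem contDiffAt_supportFun (hK : IsSmoothStrictlyConvexBody K) {x : Euc n} (hx : x ≠ 0) :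
    ContDiffAt ℝ ∞ (supportFun K) x := by
  obtain ⟨q, hq, hqx⟩ := exists_supportFun_eq hK.isCompact hK.nonempty x
  have hfr := mem_frontier_of_supportFun_eq hK.isCompact hx hq hqx
  obtain ⟨U, ρ, hU, hqU, hρ, hKU, hne, hpos⟩ := hK.boundary q hfr
  have hc : ContDiffAt ℝ ∞ ρ q := hρ.contDiffAt (hU.mem_nhds hqU)
  have hq0 := eq_zero_of_mem_frontier hK.isCompact.isClosed hU hqU hKU hc.continuousAt hfr
  obtain ⟨l, hl, rfl⟩ := exists_smul_gradient_eq_normal hU hqU hKU (hc.differentiableAt (by simp))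
    hq0 hne (x := x) (fun k hk => by rw [← hqx]; exact inner_le_supportFun hK.isCompact _ hk)
  have hl0 : l ≠ 0 := fun h => hx (by rw [h, zero_smul])
  exact contDiffAt_supportFun_of_boundary hK.convex hU hqU hρ hKU hne hpos hq0
    (lt_of_le_of_ne hl hl0.symm)

theorem differentiableAt_supportFun (hK : IsSmoothStrictlyConvexBody K) {x : Euc n} (hx : x ≠ 0) :
    DifferentiableAt ℝ (supportFun K) x :=
  (hK.contDiffAt_supportFun hx).differentiableAt (by simp)

theorem gradient_mem_and_supportFun_eq (hK : IsSmoothStrictlyConvexBody K) {x : Euc n}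
    (hx : x ≠ 0) :
    gradient (supportFun K) x ∈ K ∧ supportFun K x = ⟪x, gradient (supportFun K) x⟫ := by
  obtain ⟨q, hq, hqx⟩ := exists_supportFun_eq hK.isCompact hK.nonempty x
  rw [gradient_supportFun_eq hK.isCompact hq hqx (hK.differentiableAt_supportFun hx)]
  exact ⟨hq, hqx⟩

theorem gradient_mem (hK : IsSmoothStrictlyConvexBody K) {x : Euc n} (hx : x ≠ 0) :
    gradient (supportFun K) x ∈ K :=
  (hK.gradient_mem_and_supportFun_eq hx).1

theorem inner_gradient (hK : IsSmoothStrictlyConvexBody K) {x : Euc n} (hx : x ≠ 0) :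
    ⟪x, gradient (supportFun K) x⟫ = supportFun K x :=
  (hK.gradient_mem_and_supportFun_eq hx).2.symm

theorem contDiffAt_gradient (hK : IsSmoothStrictlyConvexBody K) {x : Euc n} (hx : x ≠ 0) :
    ContDiffAt ℝ ∞ (gradient (supportFun K)) x :=
  (InnerProductSpace.toDual ℝ (Euc n)).symm.contDiff.contDiffAt.comp x
    ((hK.contDiffAt_supportFun hx).fderiv_right (by simp))

theorem gradient_smul (hK : IsSmoothStrictlyConvexBody K) {t : ℝ} (ht : 0 < t) {x : Euc n}
    (hx : x ≠ 0) : gradient (supportFun K) (t • x) = gradient (supportFun K) x := by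
  refine gradient_supportFun_eq hK.isCompact (hK.gradient_mem hx) ?_
    (hK.differentiableAt_supportFun (smul_ne_zero ht.ne' hx))
  rw [supportFun_smul ht.le, real_inner_smul_left, hK.inner_gradient hx]

/-- A boundary point has only one outer normal ray, that of `∇ρ`. -/
theorem exists_smul_eq_of_gradient_eq (hK : IsSmoothStrictlyConvexBody K) {x y : Euc n}
    (hx : x ≠ 0) (hy : y ≠ 0)
    (h : gradient (supportFun K) x = gradient (supportFun K) y) : ∃ t : ℝ, 0 < t ∧ x = t • y := by
  have aux : ∀ z : Euc n, z ≠ 0 → gradient (supportFun K) z = gradient (supportFun K) y →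
      ∀ k ∈ K, ⟪z, k⟫ ≤ ⟪z, gradient (supportFun K) y⟫ := fun z hz hzy k hk => by
    rw [← hzy, hK.inner_gradient hz]
    exact inner_le_supportFun hK.isCompact z hk
  have hfr := mem_frontier_of_supportFun_eq hK.isCompact hy (hK.gradient_mem hy)
    (hK.inner_gradient hy).symm
  obtain ⟨U, ρ, hU, hqU, hρ, hKU, hne, -⟩ := hK.boundary _ hfr
  have hc := hρ.contDiffAt (hU.mem_nhds hqU)
  have hq0 := eq_zero_of_mem_frontier hK.isCompact.isClosed hU hqU hKU hc.continuousAt hfr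
  have hd := hc.differentiableAt (by simp)
  obtain ⟨a, ha, hax⟩ := exists_smul_gradient_eq_normal hU hqU hKU hd hq0 hne (aux x hx h)
  obtain ⟨b, hb, hby⟩ := exists_smul_gradient_eq_normal hU hqU hKU hd hq0 hne (aux y hy rfl)
  have ha0 : a ≠ 0 := fun h => hx (by rw [hax, h, zero_smul])
  have hb0 : b ≠ 0 := fun h => hy (by rw [hby, h, zero_smul])
  refine ⟨a / b, div_pos (lt_of_le_of_ne ha ha0.symm) (lt_of_le_of_ne hb hb0.symm), ?_⟩
  rw [hby, smul_smul, div_mul_cancel₀ _ hb0, ← hax]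

theorem exists_gradient_eq (hK : IsSmoothStrictlyConvexBody K) {q : Euc n} (hq : q ∈ frontier K) :
    ∃ x : Euc n, x ≠ 0 ∧ gradient (supportFun K) x = q := by
  obtain ⟨U, ρ, hU, hqU, hρ, hKU, hne, -⟩ := hK.boundary q hq
  have hc := hρ.contDiffAt (hU.mem_nhds hqU)
  have hq0 := eq_zero_of_mem_frontier hK.isCompact.isClosed hU hqU hKU hc.continuousAt hq
  have hx : gradient ρ q ≠ 0 := by
    intro h
    apply hne
    ext v
    rw [← inner_gradient_eq_fderiv, h]; simp
  have hqK := hK.isCompact.isClosed.frontier_subset hq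
  refine ⟨gradient ρ q, hx, gradient_supportFun_eq hK.isCompact hqK ?_
    (hK.differentiableAt_supportFun hx)⟩
  refine supportFun_eq_of_forall_le hqK fun k hk => ?_
  have h1 := fderiv_sub_nonpos_of_convex hK.convex hU hqU hKU (hc.differentiableAt (by simp)) hq0 hk
  rw [← inner_gradient_eq_fderiv, inner_sub_right] at h1
  linarith

end IsSmoothStrictlyConvexBody

/-! ### The cone map, its Jacobian and its bijectivity. -/

/-- The map `r x ↦ r X(x)`, for `r ≥ 0` and `x` in the unit sphere, where `X` is the inverse Gauss
map. -/
noncomputable def coneMap {n : ℕ} (K : Set (Euc n)) (y : Euc n) : Euc n :=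
  ‖y‖ • gradient (supportFun K) y

/-- The Jacobian determinant of `coneMap`. -/
noncomputable def coneDensity {n : ℕ} (K : Set (Euc n)) (y : Euc n) : ℝ :=
  (fderiv ℝ (coneMap K) y).det

section NormDeriv

variable {n : ℕ}

theorem hasFDerivAt_norm_euc {y : Euc n} (hy : y ≠ 0) :
    HasFDerivAt (fun z : Euc n => ‖z‖) (‖y‖⁻¹ • innerSL ℝ y) y := by
  have h1 : HasFDerivAt (fun z : Euc n => Real.sqrt (‖z‖ ^ 2))
      ((1 / (2 * Real.sqrt (‖y‖ ^ 2))) • (2 • innerSL ℝ y)) y :=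
    (hasStrictFDerivAt_norm_sq y).hasFDerivAt.sqrt (pow_ne_zero _ (norm_ne_zero_iff.2 hy))
  have h2 : (fun z : Euc n => Real.sqrt (‖z‖ ^ 2)) = fun z => ‖z‖ :=
    funext fun z => Real.sqrt_sq (norm_nonneg z)
  rw [h2, Real.sqrt_sq (norm_nonneg y)] at h1
  refine h1.congr_fderiv (ContinuousLinearMap.ext fun v => ?_)
  have := norm_ne_zero_iff.2 hy
  simp
  field_simp

theorem hasFDerivAt_norm_inv_euc {y : Euc n} (hy : y ≠ 0) :
    HasFDerivAt (fun z : Euc n => ‖z‖⁻¹) (-(‖y‖⁻¹ ^ 3) • innerSL ℝ y) y := by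
  have h := (hasDerivAt_inv (norm_ne_zero_iff.2 hy)).comp_hasFDerivAt y (hasFDerivAt_norm_euc hy)
  refine h.congr_fderiv (ContinuousLinearMap.ext fun v => ?_)
  simp
  ring

theorem gradient_eq_of_hasFDerivAt {f : Euc n → ℝ} {f' : Euc n →L[ℝ] ℝ} {y g : Euc n}
    (h : HasFDerivAt f f' y) (hg : ∀ v, f' v = ⟪g, v⟫) : gradient f y = g := by
  refine ext_inner_right ℝ fun v => ?_
  rw [inner_gradient_eq_fderiv, h.fderiv, hg]

theorem norm_eq_one_of_mem (x : Sph n) : ‖(x : Euc n)‖ = 1 := by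
  simp

theorem ne_zero_of_norm_eq_one {x : Euc n} (hx : ‖x‖ = 1) : x ≠ 0 := by
  rintro rfl; simp at hx

end NormDeriv

namespace IsSmoothStrictlyConvexBody

variable {n : ℕ} {K : Set (Euc n)}

theorem hasFDerivAt_gradient (hK : IsSmoothStrictlyConvexBody K) {x : Euc n} (hx : x ≠ 0) :
    HasFDerivAt (gradient (supportFun K)) (fderiv ℝ (gradient (supportFun K)) x) x :=
  ((hK.contDiffAt_gradient hx).differentiableAt (by simp)).hasFDerivAt

theorem hasFDerivAt_supportFun (hK : IsSmoothStrictlyConvexBody K) {x : Euc n} (hx : x ≠ 0) :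
    HasFDerivAt (supportFun K) (innerSL ℝ (gradient (supportFun K) x)) x := by
  refine (hK.differentiableAt_supportFun hx).hasFDerivAt.congr_fderiv
    (ContinuousLinearMap.ext fun v => ?_)
  rw [innerSL_apply_apply, inner_gradient_eq_fderiv]

theorem sphGrad_supportFun (hK : IsSmoothStrictlyConvexBody K) {y : Euc n} (hy : y ≠ 0) :
    sphGrad (supportFun K) y =
      ‖y‖⁻¹ • gradient (supportFun K) y - (‖y‖⁻¹ ^ 3 * supportFun K y) • y := by
  have h : radialExt (supportFun K) = fun z => ‖z‖⁻¹ * supportFun K z :=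
    funext fun z => supportFun_smul (inv_nonneg.2 (norm_nonneg z)) z
  rw [sphGrad, h]
  refine gradient_eq_of_hasFDerivAt
    ((hasFDerivAt_norm_inv_euc hy).mul (hK.hasFDerivAt_supportFun hy)) fun v => ?_
  simp [inner_sub_left, real_inner_smul_left]
  ring

/-- Differentiate Euler's relation `⟪x, ∇h(x)⟫ = h(x)`: the terms `⟪v, ∇h⟫` cancel. -/
theorem inner_fderiv_gradient_eq_zero (hK : IsSmoothStrictlyConvexBody K) {x : Euc n}
    (hx : x ≠ 0) (v : Euc n) : ⟪x, fderiv ℝ (gradient (supportFun K)) x v⟫ = 0 := by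
  have h1 := (hasFDerivAt_id x).inner ℝ (hK.hasFDerivAt_gradient hx)
  have h2 : (fun y => ⟪id y, gradient (supportFun K) y⟫) =ᶠ[𝓝 x] supportFun K := by
    filter_upwards [isOpen_ne.mem_nhds hx] with y hy
    exact hK.inner_gradient hy
  have h3 := DFunLike.congr_fun
    ((h1.congr_of_eventuallyEq h2.symm).unique (hK.hasFDerivAt_supportFun hx)) v
  simpa [fderivInnerCLM_apply, real_inner_comm] using h3

theorem hasFDerivAt_coneMap (hK : IsSmoothStrictlyConvexBody K) {y : Euc n} (hy : y ≠ 0) :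
    HasFDerivAt (coneMap K) (‖y‖ • fderiv ℝ (gradient (supportFun K)) y +
      (‖y‖⁻¹ • innerSL ℝ y).smulRight (gradient (supportFun K) y)) y :=
  (hasFDerivAt_norm_euc hy).smul (hK.hasFDerivAt_gradient hy)

/-- Identifies `∇²h + h g` with the Euclidean Hessian on `xᗮ`. Differentiating the spherical
gradient along `v` produces the Hessian term, `-h v`, and a multiple of `x` that the projection
removes. -/
theorem sphHess_add_apply (hK : IsSmoothStrictlyConvexBody K) {x : Euc n} (hx : ‖x‖ = 1)
    (v : ((ℝ ∙ x)ᗮ : Submodule ℝ (Euc n))) :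
    (((sphHess (supportFun K) x + supportFun K x •
      ContinuousLinearMap.id ℝ ((ℝ ∙ x)ᗮ : Submodule ℝ (Euc n))) v :
      ((ℝ ∙ x)ᗮ : Submodule ℝ (Euc n))) : Euc n) =
      fderiv ℝ (gradient (supportFun K)) x v := by
  have hx0 := ne_zero_of_norm_eq_one hx
  have hev : sphGrad (supportFun K) =ᶠ[𝓝 x] fun y =>
      ‖y‖⁻¹ • gradient (supportFun K) y - (‖y‖⁻¹ ^ 3 * supportFun K y) • y := by
    filter_upwards [isOpen_ne.mem_nhds hx0] with y hy
    exact hK.sphGrad_supportFun hy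
  have hd := ((hasFDerivAt_norm_inv_euc hx0).smul (hK.hasFDerivAt_gradient hx0)).sub
    ((((hasFDerivAt_norm_inv_euc hx0).pow 3).mul (hK.hasFDerivAt_supportFun hx0)).smul
      (hasFDerivAt_id x))
  have hv : ⟪x, (v : Euc n)⟫ = 0 := Submodule.mem_orthogonal_singleton_iff_inner_right.1 v.2
  have hmem : fderiv ℝ (gradient (supportFun K)) x v ∈ ((ℝ ∙ x)ᗮ : Submodule ℝ (Euc n)) :=
    Submodule.mem_orthogonal_singleton_iff_inner_right.2 (hK.inner_fderiv_gradient_eq_zero hx0 v)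
  have hval : fderiv ℝ (sphGrad (supportFun K)) x v =
      (fderiv ℝ (gradient (supportFun K)) x v - supportFun K x • (v : Euc n)) -
        ⟪gradient (supportFun K) x, (v : Euc n)⟫ • x := by
    rw [(hd.congr_of_eventuallyEq hev).fderiv]
    simp [hx, hv]
    abel
  have hproj : ((((ℝ ∙ x)ᗮ : Submodule ℝ (Euc n)).orthogonalProjectionOnto
      (fderiv ℝ (sphGrad (supportFun K)) x v) : ((ℝ ∙ x)ᗮ : Submodule ℝ (Euc n))) : Euc n) =
      fderiv ℝ (gradient (supportFun K)) x v - supportFun K x • (v : Euc n) := by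
    rw [hval, map_sub]
    have h1 : ((ℝ ∙ x)ᗮ : Submodule ℝ (Euc n)).orthogonalProjectionOnto
        (⟪gradient (supportFun K) x, (v : Euc n)⟫ • x) = 0 := by
      apply Submodule.orthogonalProjectionOnto_orthogonal_apply_eq_zero
      exact Submodule.smul_mem _ _ (Submodule.mem_span_singleton_self x)
    have h2 := Submodule.orthogonalProjectionOnto_mem_subspace_eq_self
      (K := ((ℝ ∙ x)ᗮ : Submodule ℝ (Euc n)))
      ⟨fderiv ℝ (gradient (supportFun K)) x v - supportFun K x • (v : Euc n),
        Submodule.sub_mem _ hmem (Submodule.smul_mem _ _ v.2)⟩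
    rw [h1, sub_zero]
    exact congrArg Subtype.val h2
  simp [sphHess, hproj]

/-- The derivative `v ↦ D²h v + ⟪x,v⟫ X` is block triangular: it preserves `xᗮ`, acting there as
`∇²h + h g`, and acts on the one-dimensional quotient as multiplication by `⟪x, X⟫ = h`. -/
theorem coneDensity_eq_mul_det (hK : IsSmoothStrictlyConvexBody K) {x : Euc n} (hx : ‖x‖ = 1) :
    coneDensity K x = supportFun K x *
      LinearMap.det (sphHess (supportFun K) x + supportFun K x •
        ContinuousLinearMap.id ℝ ((ℝ ∙ x)ᗮ : Submodule ℝ (Euc n)) :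
          ((ℝ ∙ x)ᗮ : Submodule ℝ (Euc n)) →ₗ[ℝ] ((ℝ ∙ x)ᗮ : Submodule ℝ (Euc n))) := by
  have hx0 := ne_zero_of_norm_eq_one hx
  set W : Submodule ℝ (Euc n) := (ℝ ∙ x)ᗮ with hW
  set e : Euc n →ₗ[ℝ] Euc n := (fderiv ℝ (coneMap K) x : Euc n →ₗ[ℝ] Euc n) with he
  have hev : ∀ v, e v = fderiv ℝ (gradient (supportFun K)) x v +
      ⟪x, v⟫ • gradient (supportFun K) x := by
    intro v
    rw [he, (hK.hasFDerivAt_coneMap hx0).fderiv]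
    simp [hx]
  have hmemW : ∀ v, v ∈ W ↔ ⟪x, v⟫ = 0 := fun v =>
    Submodule.mem_orthogonal_singleton_iff_inner_right
  have heW : W ≤ W.comap e := by
    intro v hv
    rw [Submodule.mem_comap, hmemW, hev, inner_add_right, hK.inner_fderiv_gradient_eq_zero hx0,
      (hmemW v).1 hv]
    simp
  have hq : W.mapQ W e heW = supportFun K x • LinearMap.id := by
    refine Submodule.linearMap_qext _ (LinearMap.ext fun u => ?_)
    simp only [LinearMap.comp_apply, Submodule.mkQ_apply, Submodule.mapQ_apply,
      LinearMap.smul_apply, LinearMap.id_apply, ← Submodule.Quotient.mk_smul]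
    rw [Submodule.Quotient.eq, hmemW, hev, inner_sub_right, inner_add_right,
      hK.inner_fderiv_gradient_eq_zero hx0, real_inner_smul_right, real_inner_smul_right,
      hK.inner_gradient hx0]
    ring
  have hr : e.restrict heW = (sphHess (supportFun K) x + supportFun K x •
        ContinuousLinearMap.id ℝ W : W →ₗ[ℝ] W) := by
    refine LinearMap.ext fun v => Subtype.ext ?_
    have h := hK.sphHess_add_apply hx v
    rw [LinearMap.coe_restrict_apply, hev, (hmemW v).1 v.2, zero_smul, add_zero, ← h]
    rfl
  have hfin : Module.finrank ℝ (Euc n ⧸ W) = 1 := by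
    have h1 := W.finrank_quotient_add_finrank
    have h2 := (ℝ ∙ x).finrank_add_finrank_orthogonal
    rw [finrank_span_singleton hx0] at h2
    rw [← hW] at h2
    omega
  have : coneDensity K x = LinearMap.det e := rfl
  rw [this, LinearMap.det_eq_det_mul_det W e heW, hq, hr, LinearMap.det_smul, hfin, LinearMap.det_id]
  ring

theorem coneDensity_eq_div (hK : IsSmoothStrictlyConvexBody K) {x : Euc n} (hx : ‖x‖ = 1) :
    coneDensity K x = supportFun K x / gaussCurv K x := by
  rw [hK.coneDensity_eq_mul_det hx, gaussCurv, div_inv_eq_mul]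

/-- The gradient of a support function is monotone: add the two support inequalities at `x` and `x +
t v`, then let `t → 0⁺` in the difference quotient. -/
theorem inner_fderiv_gradient_self_nonneg (hK : IsSmoothStrictlyConvexBody K) {x : Euc n}
    (hx : x ≠ 0) (v : Euc n) : 0 ≤ ⟪fderiv ℝ (gradient (supportFun K)) x v, v⟫ := by
  have hline : HasDerivAt (fun t : ℝ => x + t • v) v 0 := by
    simpa using ((hasDerivAt_id (0 : ℝ)).smul_const v).const_add x
  have hder : HasDerivAt (fun t : ℝ => ⟪gradient (supportFun K) (x + t • v), v⟫)
      ⟪fderiv ℝ (gradient (supportFun K)) x v, v⟫ 0 := by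
    have h1 : HasFDerivAt (gradient (supportFun K)) (fderiv ℝ (gradient (supportFun K)) x)
        (x + (0 : ℝ) • v) := by simpa using hK.hasFDerivAt_gradient hx
    simpa using (h1.comp_hasDerivAt (0 : ℝ) hline).inner ℝ (hasDerivAt_const (0 : ℝ) v)
  have hs := (hasDerivWithinAt_iff_tendsto_slope' (s := Set.Ioi (0 : ℝ)) (by simp)).1
    hder.hasDerivWithinAt
  have hne : ∀ᶠ t : ℝ in 𝓝[>] 0, x + t • v ≠ 0 := by
    exact nhdsWithin_le_nhds (hline.continuousAt.eventually_ne (by simpa using hx))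
  refine ge_of_tendsto hs ?_
  filter_upwards [hne, self_mem_nhdsWithin] with t ht (ht0 : 0 < t)
  simp only [slope_def_field, zero_smul, add_zero, sub_zero]
  refine div_nonneg ?_ ht0.le
  have h1 := inner_le_supportFun hK.isCompact (x + t • v) (hK.gradient_mem hx)
  have h2 := inner_le_supportFun hK.isCompact x (hK.gradient_mem ht)
  rw [← hK.inner_gradient ht] at h1
  rw [← hK.inner_gradient hx] at h2
  simp only [inner_add_left, real_inner_smul_left] at h1
  rw [real_inner_comm v, real_inner_comm v]
  have h3 : 0 ≤ t * (⟪v, gradient (supportFun K) (x + t • v)⟫ -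
      ⟪v, gradient (supportFun K) x⟫) := by linarith
  exact (mul_nonneg_iff_of_pos_left ht0).1 h3

theorem inner_fderiv_gradient_symm (hK : IsSmoothStrictlyConvexBody K) {x : Euc n}
    (hx : x ≠ 0) (v w : Euc n) :
    ⟪fderiv ℝ (gradient (supportFun K)) x v, w⟫ =
      ⟪fderiv ℝ (gradient (supportFun K)) x w, v⟫ := by
  have h1 := ((hK.contDiffAt_supportFun hx).fderiv_right (m := ∞) (by simp)).differentiableAt
    (by simp)
  have h2 := (hK.hasFDerivAt_gradient hx).differentiableAt
  rw [inner_fderiv_gradient h1 h2, inner_fderiv_gradient h1 h2]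
  exact (hK.contDiffAt_supportFun hx).isSymmSndFDerivAt
    (by simpa using ENat.LEInfty.out) v w

theorem coneDensity_nonneg (hK : IsSmoothStrictlyConvexBody K) (h0 : (0 : Euc n) ∈ interior K)
    {x : Euc n} (hx : ‖x‖ = 1) : 0 ≤ coneDensity K x := by
  have hx0 := ne_zero_of_norm_eq_one hx
  rw [hK.coneDensity_eq_mul_det hx]
  refine mul_nonneg (supportFun_pos hK.isCompact h0 hx0).le ?_
  set A : ((ℝ ∙ x)ᗮ : Submodule ℝ (Euc n)) →ₗ[ℝ] ((ℝ ∙ x)ᗮ : Submodule ℝ (Euc n)) :=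
    sphHess (supportFun K) x + supportFun K x •
        ContinuousLinearMap.id ℝ ((ℝ ∙ x)ᗮ : Submodule ℝ (Euc n))
  have hA : ∀ v, ((A v : ((ℝ ∙ x)ᗮ : Submodule ℝ (Euc n))) : Euc n) =
    fderiv ℝ (gradient (supportFun K)) x v := hK.sphHess_add_apply hx
  have hpos : A.IsPositive := by
    refine ⟨fun v w => ?_, fun v => ?_⟩
    · rw [Submodule.coe_inner, Submodule.coe_inner, hA, hA, hK.inner_fderiv_gradient_symm hx0,
        real_inner_comm]
    · rw [Submodule.coe_inner, hA]
      exact hK.inner_fderiv_gradient_self_nonneg hx0 v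
  rw [hpos.isSymmetric.det_eq_prod_eigenvalues rfl]
  exact Finset.prod_nonneg fun i _ => hpos.nonneg_eigenvalues rfl i

theorem coneMap_smul (hK : IsSmoothStrictlyConvexBody K) {t : ℝ} (ht : 0 < t) (y : Euc n) :
    coneMap K (t • y) = t • coneMap K y := by
  rcases eq_or_ne y 0 with rfl | hy
  · simp [coneMap]
  · rw [coneMap, coneMap, hK.gradient_smul ht hy, norm_smul, Real.norm_of_nonneg ht.le, smul_smul]

theorem coneDensity_smul (hK : IsSmoothStrictlyConvexBody K) {t : ℝ} (ht : 0 < t) (y : Euc n) :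
    coneDensity K (t • y) = coneDensity K y := by
  have h : (fun z => coneMap K (t • z)) = fun z => t • coneMap K z :=
    funext fun z => hK.coneMap_smul ht z
  have h1 := fderiv_comp_smul (f := coneMap K) (x := y) t
  have h2 : fderiv ℝ (fun z => t • coneMap K z) y = t • fderiv ℝ (coneMap K) y :=
    congrFun (fderiv_const_smul_field (f := coneMap K) t) y
  rw [h, h2] at h1
  rw [coneDensity, coneDensity, smul_right_injective _ ht.ne' h1]

theorem contDiffAt_coneMap (hK : IsSmoothStrictlyConvexBody K) {y : Euc n} (hy : y ≠ 0) :
    ContDiffAt ℝ ∞ (coneMap K) y :=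
  (contDiffAt_norm ℝ hy).smul (hK.contDiffAt_gradient hy)

theorem continuousAt_coneDensity (hK : IsSmoothStrictlyConvexBody K) {y : Euc n} (hy : y ≠ 0) :
    ContinuousAt (coneDensity K) y :=
  (ContinuousLinearMap.continuous_det).continuousAt.comp
    (f := fderiv ℝ (coneMap K))
    ((hK.contDiffAt_coneMap hy).fderiv_right (m := ∞) (by simp)).continuousAt

/-- Pairing `‖u‖ X(u) = ‖w‖ X(w)` with `u`, and using `⟪u, X(w)⟫ ≤ h(u)`, gives `‖u‖ ≤ ‖w‖`. By
symmetry the norms agree, hence so do the points `X`, and the normal ray is unique. -/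
theorem injOn_coneMap (hK : IsSmoothStrictlyConvexBody K) (h0 : (0 : Euc n) ∈ interior K) :
    Set.InjOn (coneMap K) {0}ᶜ := by
  intro y (hy : y ≠ 0) z (hz : z ≠ 0) h
  have hposX : ∀ u : Euc n, u ≠ 0 → gradient (supportFun K) u ≠ 0 := fun u hu hu0 => by
    have := supportFun_pos hK.isCompact h0 hu
    rw [← hK.inner_gradient hu, hu0] at this
    simp at this
  have hle : ∀ u w : Euc n, u ≠ 0 → w ≠ 0 → coneMap K u = coneMap K w → ‖u‖ ≤ ‖w‖ := by
    intro u w hu hw huw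
    have h1 := inner_le_supportFun hK.isCompact u (hK.gradient_mem hw)
    have h2 : ‖w‖ * ⟪u, gradient (supportFun K) w⟫ = ‖u‖ * supportFun K u := by
      have := congrArg (fun a => ⟪u, a⟫) huw
      simp only [coneMap, real_inner_smul_right] at this
      rw [← this, hK.inner_gradient hu]
    have h3 := supportFun_pos hK.isCompact h0 hu
    have h4 := mul_le_mul_of_nonneg_left h1 (norm_nonneg w)
    rw [h2] at h4
    exact le_of_mul_le_mul_right h4 h3
  have hn : ‖y‖ = ‖z‖ := le_antisymm (hle y z hy hz h) (hle z y hz hy h.symm)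
  have hg : gradient (supportFun K) y = gradient (supportFun K) z := by
    simp only [coneMap, hn] at h
    exact smul_right_injective _ (norm_ne_zero_iff.2 hz) h
  obtain ⟨t, ht, rfl⟩ := hK.exists_smul_eq_of_gradient_eq hy hz hg
  rw [norm_smul, Real.norm_of_nonneg ht.le] at hn
  have : t = 1 := by
    have := norm_pos_iff.2 hz
    exact mul_right_cancel₀ this.ne' (by linarith)
  rw [this, one_smul]

/-- Dividing `z` by its gauge lands on the boundary, where a normal exists; homogeneity scales back.
-/
theorem exists_coneMap_eq (hK : IsSmoothStrictlyConvexBody K) (h0 : (0 : Euc n) ∈ interior K)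
    {z : Euc n} (hz : z ≠ 0) : ∃ y : Euc n, y ≠ 0 ∧ coneMap K y = z := by
  have hKn : K ∈ 𝓝 (0 : Euc n) := mem_interior_iff_mem_nhds.1 h0
  have hg : 0 < gauge K z := (gauge_pos (absorbent_nhds_zero hKn)
    (NormedSpace.isVonNBounded_of_isBounded ℝ hK.isCompact.isBounded)).2 hz
  have hfr : (gauge K z)⁻¹ • z ∈ frontier K := by
    rw [← gauge_eq_one_iff_mem_frontier hK.convex hKn, gauge_smul_of_nonneg (inv_nonneg.2 hg.le),
      smul_eq_mul, inv_mul_cancel₀ hg.ne']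
  obtain ⟨x, hx, hxz⟩ := hK.exists_gradient_eq hfr
  have hxn := norm_pos_iff.2 hx
  refine ⟨(gauge K z * ‖x‖⁻¹) • x, smul_ne_zero (by positivity) hx, ?_⟩
  rw [hK.coneMap_smul (by positivity), coneMap, hxz, smul_smul, smul_smul]
  field_simp
  simp

end IsSmoothStrictlyConvexBody

/-! ### Polar coordinates. -/

section Polar

variable {n : ℕ}

instance isFiniteMeasure_sphMeasure (n : ℕ) : IsFiniteMeasure (sphMeasure n) :=
  inferInstanceAs (IsFiniteMeasure (volume : Measure (Euc n)).toSphere)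

theorem measurePreserving_polar (n : ℕ) :
    MeasurePreserving (homeomorphUnitSphereProd (Euc n))
      ((volume : Measure (Euc n)).comap Subtype.val)
      ((sphMeasure n).prod (Measure.volumeIoiPow n)) := by
  have h := (volume : Measure (Euc n)).measurePreserving_homeomorphUnitSphereProd
  rwa [finrank_euclideanSpace_fin, Nat.add_sub_cancel] at h

theorem polar_smul_eq (y : ({0}ᶜ : Set (Euc n))) :
    (((homeomorphUnitSphereProd (Euc n)) y).2 : ℝ) •
      (((homeomorphUnitSphereProd (Euc n)) y).1 : Euc n) = y := by
  have : ‖(y : Euc n)‖ ≠ 0 := norm_ne_zero_iff.2 y.2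
  simp [smul_smul, this]

theorem lintegral_polar {F : Euc n → ENNReal} (hF : Measurable F) :
    ∫⁻ y, F y = ∫⁻ x : Sph n, ∫⁻ r : Set.Ioi (0 : ℝ), F ((r : ℝ) • (x : Euc n))
      ∂(Measure.volumeIoiPow n) ∂(sphMeasure n) := by
  have h1 : ∫⁻ y, F y = ∫⁻ y : ({0}ᶜ : Set (Euc n)), F y ∂((volume : Measure (Euc n)).comap
      Subtype.val) := by
    rw [lintegral_subtype_comap (measurableSet_singleton _).compl, restrict_compl_singleton]
  have h2 := (measurePreserving_polar n).lintegral_comp_emb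
    (Homeomorph.measurableEmbedding _)
    (fun z : Sph n × Set.Ioi (0 : ℝ) => F ((z.2 : ℝ) • (z.1 : Euc n)))
  simp only [polar_smul_eq] at h2
  rw [h1, h2, lintegral_prod]
  exact (hF.comp (by fun_prop)).aemeasurable

theorem integral_polar (F : Euc n → ℝ) :
    ∫ y, F y = ∫ z : Sph n × Set.Ioi (0 : ℝ), F ((z.2 : ℝ) • (z.1 : Euc n))
      ∂((sphMeasure n).prod (Measure.volumeIoiPow n)) := by
  have h1 : ∫ y, F y = ∫ y : ({0}ᶜ : Set (Euc n)), F y ∂((volume : Measure (Euc n)).comap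
      Subtype.val) := by
    rw [integral_subtype_comap (measurableSet_singleton _).compl, restrict_compl_singleton]
  have h2 := (measurePreserving_polar n).integral_comp
    (Homeomorph.measurableEmbedding _)
    (fun z : Sph n × Set.Ioi (0 : ℝ) => F ((z.2 : ℝ) • (z.1 : Euc n)))
  simp only [polar_smul_eq] at h2
  rw [h1, h2]

theorem volumeIoiPow_setOf_le (n : ℕ) {R : ℝ} (hR : 0 < R) :
    Measure.volumeIoiPow n {r | (r : ℝ) ≤ R} = ENNReal.ofReal (R ^ (n + 1) / (n + 1)) := by
  have h1 : {r : Set.Ioi (0 : ℝ) | (r : ℝ) ≤ R} = Set.Iio ⟨R, hR⟩ ∪ {⟨R, hR⟩} := by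
    ext r
    simp [Subtype.ext_iff, ← Subtype.coe_lt_coe, le_iff_lt_or_eq]
  have h2 : Measure.volumeIoiPow n {(⟨R, hR⟩ : Set.Ioi (0 : ℝ))} = 0 := by
    refine withDensity_absolutelyContinuous _ _ ?_
    rw [comap_subtype_coe_apply measurableSet_Ioi]
    simp
  have h3 := Measure.volumeIoiPow_apply_Iio n ⟨R, hR⟩
  rw [h1]
  refine le_antisymm ((measure_union_le _ _).trans ?_) ?_
  · rw [h2, add_zero, h3]
  · rw [← h3]; exact measure_mono Set.subset_union_left

/-- On each ray `G` and `R` are constant, so the radial integral is the mass of `(0, R]` for `r^n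
dr`. -/
theorem setLIntegral_starShaped {G : Euc n → ENNReal} {R : Euc n → ℝ} (hGm : Measurable G)
    (hRm : Measurable R) (hG : ∀ t : ℝ, 0 < t → ∀ y, G (t • y) = G y)
    (hR : ∀ t : ℝ, 0 < t → ∀ y, R (t • y) = R y) (hpos : ∀ x : Sph n, 0 < R x) :
    ∫⁻ y in {y | ‖y‖ ≤ R y}, G y =
      ∫⁻ x : Sph n, G x * ENNReal.ofReal (R x ^ (n + 1) / (n + 1)) ∂(sphMeasure n) := by
  have hm : MeasurableSet {y : Euc n | ‖y‖ ≤ R y} := measurableSet_le measurable_norm hRm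
  rw [← lintegral_indicator hm, lintegral_polar (hGm.indicator hm)]
  refine lintegral_congr fun x => ?_
  have h1 : ∀ r : Set.Ioi (0 : ℝ), ({y | ‖y‖ ≤ R y}.indicator G) ((r : ℝ) • (x : Euc n)) =
      {r : Set.Ioi (0 : ℝ) | (r : ℝ) ≤ R x}.indicator (fun _ => G x) r := by
    intro r
    have hr : (0 : ℝ) < r := r.2
    simp only [Set.indicator, Set.mem_ofPred_eq]
    simp only [hG r hr, hR r hr, norm_smul, norm_eq_one_of_mem, mul_one, Real.norm_of_nonneg hr.le]
  simp only [h1]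
  rw [lintegral_indicator_const (measurableSet_le measurable_subtype_coe measurable_const),
    volumeIoiPow_setOf_le n (hpos x)]

theorem Continuous.integrable_sphere {E : Type*} [NormedAddCommGroup E] {f : Sph n → E}
    (hf : Continuous f) (μ : Measure (Sph n)) [IsFiniteMeasure μ] : Integrable f μ :=
  hf.integrable_of_hasCompactSupport (HasCompactSupport.of_compactSpace f)

end Polar

/-! ### Differentiation under the integral sign. -/

section Derivative

theorem hasDerivAt_integral_mul_inv_pow {α : Type*} [MeasurableSpace α] {μ : Measure α}
    [IsFiniteMeasure μ] {u w : α → ℝ} (hu : AEStronglyMeasurable u μ)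
    (hw : AEStronglyMeasurable w μ) {M W : ℝ} (hM : ∀ x, |u x| ≤ M) (hW : ∀ x, |w x| ≤ W)
    (m : ℕ) :
    HasDerivAt (fun t : ℝ => ∫ x, w x * ((1 + t * u x)⁻¹) ^ m ∂μ)
      (-(m * ∫ x, w x * u x ∂μ)) 0 := by
  rcases isEmpty_or_nonempty α with hα | ⟨⟨x0⟩⟩
  · simp [Subsingleton.elim μ 0, hasDerivAt_const]
  have hM0 : 0 ≤ M := (abs_nonneg _).trans (hM x0)
  have hW0 : 0 ≤ W := (abs_nonneg _).trans (hW x0)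
  -- For `|t| < δ` this keeps `1 + t u ≥ 1/2`, so inverses are at most `2`; `M + 1` avoids inverting
  -- `0`.
  set δ : ℝ := (2 * (M + 1))⁻¹ with hδ
  have hδ0 : 0 < δ := by positivity
  have hlow : ∀ x, ∀ t ∈ ball (0 : ℝ) δ, 1 / 2 ≤ 1 + t * u x := by
    intro x t ht
    have ht' : |t| < δ := by simpa using ht
    have h1 : |t * u x| ≤ δ * (M + 1) := by
      rw [abs_mul]
      exact mul_le_mul ht'.le ((hM x).trans (by linarith)) (abs_nonneg _) hδ0.le
    have h2 : δ * (M + 1) = 1 / 2 := by rw [hδ]; field_simp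
    have := neg_abs_le (t * u x)
    linarith
  have hder : ∀ x, ∀ t ∈ ball (0 : ℝ) δ, HasDerivAt (fun t : ℝ => w x * ((1 + t * u x)⁻¹) ^ m)
      (w x * (m * ((1 + t * u x)⁻¹) ^ (m - 1) * (-(u x) / (1 + t * u x) ^ 2))) t := by
    intro x t ht
    have h0 : 1 + t * u x ≠ 0 := by have := hlow x t ht; linarith
    have h1 : HasDerivAt (fun t : ℝ => 1 + t * u x) (u x) t := by
      simpa using ((hasDerivAt_id t).mul_const (u x)).const_add 1
    exact ((h1.inv h0).pow m).const_mul (w x)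
  have hmeas : ∀ t : ℝ, AEStronglyMeasurable (fun x => w x * ((1 + t * u x)⁻¹) ^ m) μ := by
    intro t
    exact (hw.aemeasurable.mul
      (((hu.aemeasurable.const_mul t).const_add 1).inv.pow_const m)).aestronglyMeasurable
  have key := hasDerivAt_integral_of_dominated_loc_of_deriv_le (μ := μ) (x₀ := (0 : ℝ))
    (F := fun t x => w x * ((1 + t * u x)⁻¹) ^ m)
    (F' := fun t x => w x * (m * ((1 + t * u x)⁻¹) ^ (m - 1) * (-(u x) / (1 + t * u x) ^ 2)))
    (bound := fun _ => W * (m * 2 ^ (m - 1) * (M * 4))) (s := ball 0 δ)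
    (ball_mem_nhds 0 hδ0) (Eventually.of_forall hmeas) ?_ ?_ ?_ (integrable_const _)
    (Eventually.of_forall fun x t ht => hder x t ht)
  · refine key.2.congr_deriv ?_
    symm
    rw [← integral_const_mul, ← integral_neg]
    refine integral_congr_ae (Eventually.of_forall fun x => ?_)
    simp
    ring
  · refine Integrable.of_bound (C := W) (hmeas 0) (Eventually.of_forall fun x => ?_)
    simpa using hW x
  · simp only [zero_mul, add_zero, inv_one, one_pow, mul_one, div_one]
    exact hw.mul (hu.neg.const_mul (m : ℝ))
  · refine Eventually.of_forall fun x t ht => ?_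
    have h1 := hlow x t ht
    have h1' : (0 : ℝ) < 1 + t * u x := by linarith
    have hi : (1 + t * u x)⁻¹ ≤ 2 := by
      rw [inv_le_comm₀ h1' two_pos]; linarith
    have hi0 : 0 < (1 + t * u x)⁻¹ := inv_pos.2 h1'
    rw [Real.norm_eq_abs, abs_mul, abs_mul, abs_mul, abs_pow, abs_of_pos hi0, Nat.abs_cast,
      div_eq_mul_inv, abs_mul, abs_neg, ← inv_pow, abs_pow, abs_of_pos hi0]
    have h4 : (1 + t * u x)⁻¹ ^ 2 ≤ 4 := by nlinarith
    gcongr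
    · exact hW x
    · exact hM x

end Derivative

/-! ### Volumes as spherical integrals of the cone density. -/

theorem measurable_coneDensity {n : ℕ} (K : Set (Euc n)) : Measurable (coneDensity K) :=
  ContinuousLinearMap.continuous_det.measurable.comp (measurable_fderiv ℝ (coneMap K))

theorem measurable_gradient {n : ℕ} (f : Euc n → ℝ) : Measurable (gradient f) :=
  (InnerProductSpace.toDual ℝ (Euc n)).symm.continuous.measurable.comp (measurable_fderiv ℝ f)

/-- The logarithmic derivative at `t = 0` of `⟪y, z + t ⟪c, z⟫ c⟫` for `z = X(y)`. -/
noncomputable def stretchRate {n : ℕ} (K : Set (Euc n)) (c y : Euc n) : ℝ :=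
  ⟪y, c⟫ * ⟪gradient (supportFun K) y, c⟫ / supportFun K y

namespace IsSmoothStrictlyConvexBody

variable {n : ℕ} {K : Set (Euc n)}

theorem measurable_supportFun (hK : IsSmoothStrictlyConvexBody K) : Measurable (supportFun K) :=
  measurable_of_continuousOn_compl_singleton 0 fun _ hx =>
    (hK.contDiffAt_supportFun hx).continuousAt.continuousWithinAt

theorem continuous_supportFun_sphere (hK : IsSmoothStrictlyConvexBody K) :
    Continuous fun x : Sph n => supportFun K (x : Euc n) :=
  continuous_iff_continuousAt.2 fun x => ContinuousAt.comp (f := Subtype.val) (g := supportFun K)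
    (hK.contDiffAt_supportFun (ne_zero_of_norm_eq_one (norm_eq_one_of_mem x))).continuousAt
    continuousAt_subtype_val

theorem continuous_gradient_sphere (hK : IsSmoothStrictlyConvexBody K) :
    Continuous fun x : Sph n => gradient (supportFun K) (x : Euc n) :=
  continuous_iff_continuousAt.2 fun x =>
    ContinuousAt.comp (f := Subtype.val) (g := gradient (supportFun K))
    (hK.contDiffAt_gradient (ne_zero_of_norm_eq_one (norm_eq_one_of_mem x))).continuousAt
    continuousAt_subtype_val

theorem continuous_coneDensity_sphere (hK : IsSmoothStrictlyConvexBody K) :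
    Continuous fun x : Sph n => coneDensity K (x : Euc n) :=
  continuous_iff_continuousAt.2 fun x =>
    ContinuousAt.comp (f := Subtype.val) (g := coneDensity K)
    (hK.continuousAt_coneDensity (ne_zero_of_norm_eq_one (norm_eq_one_of_mem x)))
    continuousAt_subtype_val

theorem supportFun_sphere_pos (hK : IsSmoothStrictlyConvexBody K)
    (h0 : (0 : Euc n) ∈ interior K) (x : Sph n) : 0 < supportFun K (x : Euc n) :=
  supportFun_pos hK.isCompact h0 (ne_zero_of_norm_eq_one (norm_eq_one_of_mem x))

/-- The Jacobian integral over a region star-shaped about the origin, in polar coordinates. -/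
theorem setLIntegral_abs_coneDensity (hK : IsSmoothStrictlyConvexBody K)
    (h0 : (0 : Euc n) ∈ interior K) {R : Euc n → ℝ} (hRm : Measurable R)
    (hR : ∀ t : ℝ, 0 < t → ∀ y, R (t • y) = R y) (hpos : ∀ x : Sph n, 0 < R x)
    (hint : Integrable (fun x : Sph n => coneDensity K (x : Euc n) * R x ^ (n + 1))
      (sphMeasure n)) :
    ∫⁻ y in {y | ‖y‖ ≤ R y}, ENNReal.ofReal |coneDensity K y| =
      ENNReal.ofReal ((∫ x : Sph n, coneDensity K (x : Euc n) * R x ^ (n + 1) ∂(sphMeasure n)) /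
        (n + 1)) := by
  have hn : (0 : ℝ) < n + 1 := by positivity
  have hD : ∀ x : Sph n, 0 ≤ coneDensity K (x : Euc n) := fun x =>
    hK.coneDensity_nonneg h0 (norm_eq_one_of_mem x)
  rw [setLIntegral_starShaped (measurable_coneDensity K).abs.ennreal_ofReal hRm
    (fun t ht y => by rw [hK.coneDensity_smul ht]) hR hpos, ← integral_div,
    ofReal_integral_eq_lintegral_ofReal (hint.div_const _)]
  · refine lintegral_congr fun x => ?_
    rw [abs_of_nonneg (hD x), ← ENNReal.ofReal_mul (hD x), mul_div_assoc]
  · exact Eventually.of_forall fun x =>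
      div_nonneg (mul_nonneg (hD x) (pow_nonneg (hpos x).le _)) hn.le

/-- Change of variables for the injective cone map; the origin is removed because differentiability
and injectivity are only established away from it. -/
theorem volume_coneMap_image (hK : IsSmoothStrictlyConvexBody K)
    (h0 : (0 : Euc n) ∈ interior K) {S : Set (Euc n)} (hS : MeasurableSet S) :
    volume (coneMap K '' (S \ {0})) = ∫⁻ y in S, ENNReal.ofReal |coneDensity K y| := by
  have hae : (S \ {0} : Set (Euc n)) =ᵐ[volume] S :=
    sdiff_null_ae_eq_self (measure_singleton _)
  rw [← setLIntegral_congr hae]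
  refine (lintegral_abs_det_fderiv_eq_addHaar_image volume
    (hS.diff (measurableSet_singleton _)) (f' := fderiv ℝ (coneMap K)) ?_ ?_).symm
  · intro y hy
    exact (hK.contDiffAt_coneMap hy.2).differentiableAt (by simp) |>.hasFDerivAt.hasFDerivWithinAt
  · exact (hK.injOn_coneMap h0).mono fun y hy => hy.2

/-- Away from the origin, `coneMap K y` lies in `K` exactly when `‖y‖ ≤ 1`: one direction is
convexity with `0 ∈ K`, the other is the support inequality in direction `y`. -/
theorem volume_eq (hK : IsSmoothStrictlyConvexBody K) (h0 : (0 : Euc n) ∈ interior K) :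
    volume K = ENNReal.ofReal ((∫ x : Sph n, coneDensity K (x : Euc n) ∂(sphMeasure n)) /
      (n + 1)) := by
  have h1 := hK.setLIntegral_abs_coneDensity h0 (R := fun _ => 1) measurable_const
    (fun _ _ _ => rfl) (fun _ => one_pos)
    (by simpa using hK.continuous_coneDensity_sphere.integrable_sphere _)
  simp only [one_pow, mul_one] at h1
  have hm : MeasurableSet {y : Euc n | ‖y‖ ≤ 1} := measurableSet_le measurable_norm measurable_const
  rw [← h1, ← hK.volume_coneMap_image h0 hm]
  have himg : coneMap K '' ({y : Euc n | ‖y‖ ≤ 1} \ {0}) = K \ {0} := by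
    ext z
    constructor
    · rintro ⟨y, ⟨hy1, hy0⟩, rfl⟩
      have hy0' : y ≠ 0 := hy0
      have hy1' : ‖y‖ ≤ 1 := hy1
      refine ⟨?_, fun h => ?_⟩
      · exact hK.convex.smul_mem_of_zero_mem (interior_subset h0) (hK.gradient_mem hy0')
          ⟨norm_nonneg y, hy1'⟩
      · have h2 := supportFun_pos hK.isCompact h0 hy0'
        have h3 := congrArg (fun a => ⟪y, a⟫) (show coneMap K y = 0 from h)
        simp only [coneMap, real_inner_smul_right, hK.inner_gradient hy0', inner_zero_right] at h3
        have := mul_pos (norm_pos_iff.2 hy0') h2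
        linarith
    · rintro ⟨hz, hz0⟩
      obtain ⟨y, hy, rfl⟩ := hK.exists_coneMap_eq h0 hz0
      refine ⟨y, ⟨?_, hy⟩, rfl⟩
      have h2 := inner_le_supportFun hK.isCompact y hz
      rw [coneMap, real_inner_smul_right, hK.inner_gradient hy] at h2
      have h3 := supportFun_pos hK.isCompact h0 hy
      exact (mul_le_iff_le_one_left h3).1 h2
  rw [himg, measure_sdiff_null (measure_singleton _)]

end IsSmoothStrictlyConvexBody

/-! ### First variation of volume under a rank-one stretch. -/

namespace IsSmoothStrictlyConvexBody

variable {n : ℕ} {K : Set (Euc n)}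

theorem measurable_stretchRate (hK : IsSmoothStrictlyConvexBody K) (c : Euc n) :
    Measurable (stretchRate K c) := by
  have h := (measurable_gradient (supportFun K)).inner_const (c := c) (𝕜 := ℝ)
  have h2 : Measurable fun y : Euc n => ⟪y, c⟫ := measurable_id.inner_const
  exact (h2.mul h).div hK.measurable_supportFun

theorem stretchRate_smul (hK : IsSmoothStrictlyConvexBody K) (c : Euc n) {t : ℝ} (ht : 0 < t)
    (y : Euc n) : stretchRate K c (t • y) = stretchRate K c y := by
  rcases eq_or_ne y 0 with rfl | hy
  · simp
  · rw [stretchRate, stretchRate, hK.gradient_smul ht hy, supportFun_smul ht.le,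
      real_inner_smul_left, mul_assoc, mul_div_mul_left _ _ ht.ne']

theorem continuous_stretchRate_sphere (hK : IsSmoothStrictlyConvexBody K)
    (h0 : (0 : Euc n) ∈ interior K) (c : Euc n) :
    Continuous fun x : Sph n => stretchRate K c (x : Euc n) := by
  have h1 : Continuous fun x : Sph n => ⟪(x : Euc n), c⟫ := by fun_prop
  have h2 : Continuous fun x : Sph n => ⟪gradient (supportFun K) (x : Euc n), c⟫ :=
    hK.continuous_gradient_sphere.inner continuous_const
  exact (h1.mul h2).div hK.continuous_supportFun_sphere
    fun x => (hK.supportFun_sphere_pos h0 x).ne'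

theorem inner_transvection_gradient (hK : IsSmoothStrictlyConvexBody K)
    (h0 : (0 : Euc n) ∈ interior K) (c : Euc n) (t : ℝ) {y : Euc n} (hy : y ≠ 0) :
    ⟪y, gradient (supportFun K) y + ⟪c, gradient (supportFun K) y⟫ • (t • c)⟫ =
      supportFun K y * (1 + t * stretchRate K c y) := by
  have := (supportFun_pos hK.isCompact h0 hy).ne'
  rw [inner_add_right, hK.inner_gradient hy, real_inner_smul_right, real_inner_smul_right,
    stretchRate, real_inner_comm c y, real_inner_comm c (gradient _ _)]
  field_simp

/-- Up to the factor `n + 1`, the left side is the volume of `T⁻¹ K` for `T z = z + t⟨c,z⟩c`, and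
the right side is the volume of the cone-map image of `‖y‖ ≤ (1 + t u(y))⁻¹`, with `u` the stretch
rate. If `z = ‖y‖ X(y)` and `T z ∈ K`, the support inequality in direction `y` is `‖y‖ h(y) (1 + t
u(y)) ≤ h(y)`, so the first set lies in the second up to the origin. -/
theorem inv_mul_integral_le (hK : IsSmoothStrictlyConvexBody K) (h0 : (0 : Euc n) ∈ interior K)
    (c : Euc n) {t : ℝ} (ht : 0 < 1 + t * ‖c‖ ^ 2)
    (htu : ∀ x : Sph n, 0 < 1 + t * stretchRate K c (x : Euc n)) :
    (1 + t * ‖c‖ ^ 2)⁻¹ * ∫ x : Sph n, coneDensity K (x : Euc n) ∂(sphMeasure n) ≤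
      ∫ x : Sph n, coneDensity K (x : Euc n) * ((1 + t * stretchRate K c (x : Euc n))⁻¹) ^ (n + 1)
        ∂(sphMeasure n) := by
  have hn : (0 : ℝ) < n + 1 := by positivity
  set R : Euc n → ℝ := fun y => (1 + t * stretchRate K c y)⁻¹ with hR
  have hRm : Measurable R := (((hK.measurable_stretchRate c).const_mul t).const_add 1).inv
  have hRs : ∀ s : ℝ, 0 < s → ∀ y, R (s • y) = R y := fun s hs y => by
    simp only [hR, hK.stretchRate_smul c hs]
  have hRpos : ∀ x : Sph n, 0 < R x := fun x => inv_pos.2 (htu x)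
  have hcont : Continuous fun x : Sph n => coneDensity K (x : Euc n) * R x ^ (n + 1) := by
    refine hK.continuous_coneDensity_sphere.mul (Continuous.pow (Continuous.inv₀ ?_ ?_) _)
    · exact continuous_const.add (continuous_const.mul (hK.continuous_stretchRate_sphere h0 c))
    · exact fun x => (htu x).ne'
  have h1 := hK.setLIntegral_abs_coneDensity h0 hRm hRs hRpos
    (hcont.integrable_sphere _)
  have hm : MeasurableSet {y : Euc n | ‖y‖ ≤ R y} := measurableSet_le measurable_norm hRm
  rw [← hK.volume_coneMap_image h0 hm] at h1
  set T : Euc n →ₗ[ℝ] Euc n :=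
    LinearMap.transvection (innerₗ (Euc n) c) (t • c) with hT
  have hTdet : LinearMap.det T = 1 + t * ‖c‖ ^ 2 := by
    rw [hT, LinearMap.transvection.det, innerₗ_apply_apply, real_inner_smul_right,
      real_inner_self_eq_norm_sq]
  have hsub : (T ⁻¹' K) \ {0} ⊆ coneMap K '' ({y : Euc n | ‖y‖ ≤ R y} \ {0}) := by
    rintro z ⟨hz, hz0⟩
    obtain ⟨y, hy, rfl⟩ := hK.exists_coneMap_eq h0 hz0
    refine ⟨y, ⟨?_, hy⟩, rfl⟩
    have h2 := inner_le_supportFun hK.isCompact y hz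
    have h3 := supportFun_pos hK.isCompact h0 hy
    have hT' : T (coneMap K y) = ‖y‖ • (gradient (supportFun K) y +
        ⟪c, gradient (supportFun K) y⟫ • (t • c)) := by
      rw [coneMap, map_smul, hT, LinearMap.transvection.apply, innerₗ_apply_apply]
    rw [hT', real_inner_smul_right, hK.inner_transvection_gradient h0 c t hy] at h2
    have hyn := norm_pos_iff.2 hy
    have h4 : 0 < 1 + t * stretchRate K c y := by
      have := htu ⟨‖y‖⁻¹ • y, by simp [norm_smul, hyn.ne']⟩
      rwa [hK.stretchRate_smul c (inv_pos.2 hyn)] at this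
    change ‖y‖ ≤ (1 + t * stretchRate K c y)⁻¹
    rw [← one_div, le_div_iff₀ h4]
    refine le_of_mul_le_mul_left ?_ h3
    linarith
  have hvol : volume (T ⁻¹' K) ≤ volume (coneMap K '' ({y : Euc n | ‖y‖ ≤ R y} \ {0})) := by
    rw [← measure_sdiff_null (s := T ⁻¹' K) (measure_singleton (0 : Euc n))]
    exact measure_mono hsub
  have hnn : ∀ x : Sph n, 0 ≤ coneDensity K (x : Euc n) := fun x =>
    hK.coneDensity_nonneg h0 (norm_eq_one_of_mem x)
  rw [h1, Measure.addHaar_preimage_linearMap volume (by rw [hTdet]; exact ht.ne'), hTdet,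
    abs_of_pos (inv_pos.2 ht), hK.volume_eq h0, ← ENNReal.ofReal_mul (inv_pos.2 ht).le,
    ENNReal.ofReal_le_ofReal_iff (div_nonneg (integral_nonneg fun x =>
      mul_nonneg (hnn x) (pow_nonneg (hRpos x).le _)) hn.le), ← mul_div_assoc,
    div_le_div_iff_of_pos_right hn] at hvol
  exact hvol

/-- The volume inequality holds for all small `t` of either sign and is an equality at `t = 0`, so
the difference of its sides has a local minimum there and zero derivative. A one-sided inclusion
thus gives an exact identity. -/
theorem integral_coneDensity_mul_stretchRate (hK : IsSmoothStrictlyConvexBody K)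
    (h0 : (0 : Euc n) ∈ interior K) (c : Euc n) :
    (n + 1) * ∫ x : Sph n, coneDensity K (x : Euc n) * stretchRate K c (x : Euc n)
      ∂(sphMeasure n) = ‖c‖ ^ 2 * ∫ x : Sph n, coneDensity K (x : Euc n) ∂(sphMeasure n) := by
  set V := ∫ x : Sph n, coneDensity K (x : Euc n) ∂(sphMeasure n) with hV
  have hu := hK.continuous_stretchRate_sphere h0 c
  have hw := hK.continuous_coneDensity_sphere
  obtain ⟨M, hM⟩ := isCompact_univ.exists_bound_of_continuousOn hu.continuousOn
  obtain ⟨W, hW⟩ := isCompact_univ.exists_bound_of_continuousOn hw.continuousOn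
  have hd1 := hasDerivAt_integral_mul_inv_pow (μ := sphMeasure n) hu.aestronglyMeasurable
    hw.aestronglyMeasurable (fun x => hM x trivial) (fun x => hW x trivial) (n + 1)
  have hd2 : HasDerivAt (fun t : ℝ => (1 + t * ‖c‖ ^ 2)⁻¹ * V) (-‖c‖ ^ 2 * V) 0 := by
    have h1 : HasDerivAt (fun t : ℝ => 1 + t * ‖c‖ ^ 2) (‖c‖ ^ 2) 0 := by
      simpa using ((hasDerivAt_id (0 : ℝ)).mul_const (‖c‖ ^ 2)).const_add 1
    simpa using (h1.inv (by simp)).mul_const V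
  have hmin : IsLocalMin (fun t : ℝ => (∫ x : Sph n, coneDensity K (x : Euc n) *
      ((1 + t * stretchRate K c (x : Euc n))⁻¹) ^ (n + 1) ∂(sphMeasure n)) -
      (1 + t * ‖c‖ ^ 2)⁻¹ * V) 0 := by
    have e1 : ∀ᶠ t : ℝ in 𝓝 0, 0 < 1 + t * ‖c‖ ^ 2 := by
      have : ContinuousAt (fun t : ℝ => 1 + t * ‖c‖ ^ 2) 0 := by fun_prop
      exact this.eventually_const_lt (by simp)
    have e2 : ∀ᶠ t : ℝ in 𝓝 0, |t| * |M| < 1 := by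
      have : ContinuousAt (fun t : ℝ => |t| * |M|) 0 := by fun_prop
      exact this.eventually_lt_const (by simp)
    filter_upwards [e1, e2] with t ht1 ht2
    have := hK.inv_mul_integral_le h0 c ht1 fun x => by
      have h1 : |t * stretchRate K c (x : Euc n)| ≤ |t| * |M| := by
        rw [abs_mul]
        exact mul_le_mul_of_nonneg_left ((hM x trivial).trans (le_abs_self M)) (abs_nonneg t)
      have := neg_abs_le (t * stretchRate K c (x : Euc n))
      linarith
    simp only [zero_mul, add_zero, inv_one, one_pow, mul_one, one_mul, ← hV, sub_self]
    linarith
  have := hmin.hasDerivAt_eq_zero (hd1.sub hd2)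
  push_cast at this
  linarith

end IsSmoothStrictlyConvexBody

/-! ### The divergence theorem on the sphere for homogeneous functions. -/

section HomogeneousDivergence

theorem continuous_rpow_mul {χ : ℝ → ℝ} (hc : Continuous χ) (h0 : χ =ᶠ[𝓝 0] 0) (a : ℝ) :
    Continuous fun r : ℝ => r ^ a * χ r := by
  refine continuous_iff_continuousAt.2 fun r => ?_
  rcases eq_or_ne r 0 with rfl | hr
  · have : (fun r : ℝ => r ^ a * χ r) =ᶠ[𝓝 0] fun _ => 0 := by
      filter_upwards [h0] with s hs
      simp [hs]
    exact continuousAt_const.congr this.symm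
  · exact (Real.continuousAt_rpow_const _ _ (Or.inl hr)).mul hc.continuousAt

theorem contDiff_rpow_mul {χ : ℝ → ℝ} (hc : ContDiff ℝ 1 χ) (h0 : χ =ᶠ[𝓝 0] 0) (a : ℝ) :
    ContDiff ℝ 1 fun r : ℝ => r ^ a * χ r := by
  refine contDiff_iff_contDiffAt.2 fun r => ?_
  rcases eq_or_ne r 0 with rfl | hr
  · have : (fun r : ℝ => r ^ a * χ r) =ᶠ[𝓝 0] fun _ => 0 := by
      filter_upwards [h0] with s hs
      simp [hs]
    exact contDiffAt_const.congr_of_eventuallyEq this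
  · exact (Real.contDiffAt_rpow_const_of_ne hr).mul hc.contDiffAt

theorem integral_volumeIoiPow (n : ℕ) (φ : ℝ → ℝ) :
    ∫ r : Set.Ioi (0 : ℝ), φ r ∂(Measure.volumeIoiPow n) =
      ∫ r in Set.Ioi (0 : ℝ), r ^ n * φ r := by
  simp only [Measure.volumeIoiPow, ENNReal.ofReal]
  rw [integral_withDensity_eq_integral_smul,
    integral_subtype_comap measurableSet_Ioi fun a => Real.toNNReal (a ^ n) • φ a,
    setIntegral_congr_fun measurableSet_Ioi fun x hx => ?_]
  · rw [NNReal.smul_def, Real.coe_toNNReal _ (pow_nonneg hx.out.le _), smul_eq_mul]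
  · exact (measurable_subtype_coe.pow_const _).real_toNNReal

theorem integrable_volumeIoiPow (n : ℕ) {φ : ℝ → ℝ}
    (h : IntegrableOn (fun r : ℝ => r ^ n * φ r) (Set.Ioi 0)) :
    Integrable (fun r : Set.Ioi (0 : ℝ) => φ r) (Measure.volumeIoiPow n) := by
  rw [integrableOn_iff_comap_subtypeVal measurableSet_Ioi] at h
  rw [Measure.volumeIoiPow, integrable_withDensity_iff_integrable_smul']
  · refine h.congr (Eventually.of_forall fun r => ?_)
    have hr : (0 : ℝ) < r := r.2
    simp [ENNReal.toReal_ofReal (pow_pos hr n).le]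
  · fun_prop
  · simp

theorem integral_fderiv_apply_eq_zero {n : ℕ} {f : Euc n → ℝ} (hf : ContDiff ℝ 1 f)
    (hc : HasCompactSupport f) (e : Euc n) : ∫ y, fderiv ℝ f y e = 0 := by
  have h := integral_mul_fderiv_eq_neg_fderiv_mul_of_integrable (μ := (volume : Measure (Euc n)))
    (f := fun _ => (1 : ℝ)) (g := f) (v := e) (by simp) ?_ ?_ (by simp)
    fun x _ => hf.differentiable one_ne_zero x
  · simpa using h
  · simp only [one_mul]
    exact ((hf.continuous_fderiv one_ne_zero).clm_apply continuous_const
      ).integrable_of_hasCompactSupport (hc.fderiv_apply (𝕜 := ℝ) e)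
  · simpa using hf.continuous.integrable_of_hasCompactSupport hc

theorem fderiv_smul_of_homogeneous {n : ℕ} {F : Euc n → ℝ} {d : ℝ}
    (hhom : ∀ t : ℝ, 0 < t → ∀ y : Euc n, y ≠ 0 → F (t • y) = t ^ d * F y) {t : ℝ} (ht : 0 < t)
    {y : Euc n} (hy : y ≠ 0) : fderiv ℝ F (t • y) = t ^ (d - 1) • fderiv ℝ F y := by
  have hev : (fun z => F (t • z)) =ᶠ[𝓝 y] fun z => t ^ d • F z := by
    filter_upwards [isOpen_ne.mem_nhds hy] with z hz
    exact hhom t ht z hz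
  have h1 := fderiv_comp_smul (f := F) (x := y) t
  have h2 : fderiv ℝ (fun z => t ^ d • F z) y = t ^ d • fderiv ℝ F y :=
    congrFun (fderiv_const_smul_field (f := F) (t ^ d)) y
  rw [hev.fderiv_eq, h2] at h1
  rw [Real.rpow_sub_one ht.ne', div_eq_inv_mul, mul_smul, h1, inv_smul_smul₀ ht.ne']

/-- Integrate `∂_e(ψ(‖y‖) F(y))`, whose total integral is zero, in polar coordinates. By homogeneity
it splits as `J₂ ∫ F⟪x,e⟫ + J₁ ∫ ∂_e F`, and a radial integration by parts gives `J₂ = -(n + d) J₁`,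
so the cut-off drops out. -/
theorem integral_fderiv_sphere_of_homogeneous {n : ℕ} {F : Euc n → ℝ} {d : ℝ}
    (hF : ∀ y : Euc n, y ≠ 0 → ContDiffAt ℝ 1 F y)
    (hhom : ∀ t : ℝ, 0 < t → ∀ y : Euc n, y ≠ 0 → F (t • y) = t ^ d * F y) (e : Euc n) :
    ∫ x : Sph n, fderiv ℝ F (x : Euc n) e ∂(sphMeasure n) =
      (n + d) * ∫ x : Sph n, F (x : Euc n) * ⟪(x : Euc n), e⟫ ∂(sphMeasure n) := by
  -- Vanishing outside `(1, 3)`, the cut-off removes both the singularity of `F` at the origin and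
  -- the behaviour at infinity, whatever the sign of `d`.
  let ψ : ContDiffBump (2 : ℝ) := ⟨1 / 2, 1, by norm_num, by norm_num⟩
  have hψ : ContDiff ℝ 1 ψ := ψ.contDiff
  have hψ1 : ∀ r : ℝ, r ≤ 1 → ψ r = 0 := fun r hr => by
    apply ψ.zero_of_le_dist
    change (1 : ℝ) ≤ dist r 2
    rw [dist_comm, Real.dist_eq]
    exact le_trans (by linarith) (le_abs_self _)
  have hψ3 : ∀ r : ℝ, 3 ≤ r → ψ r = 0 := fun r hr => by
    apply ψ.zero_of_le_dist
    change (1 : ℝ) ≤ dist r 2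
    rw [Real.dist_eq]
    exact le_trans (by linarith) (le_abs_self _)
  have hψ0 : (ψ : ℝ → ℝ) =ᶠ[𝓝 0] 0 := by
    filter_upwards [Iio_mem_nhds (show (0 : ℝ) < 1 by norm_num)] with r hr
    exact hψ1 r (le_of_lt hr)
  have hψ0' : deriv (ψ : ℝ → ℝ) =ᶠ[𝓝 0] 0 := by
    have := hψ0.deriv
    filter_upwards [this] with r hr
    rw [hr]; simp
  -- the radial integrals
  have hcs : HasCompactSupport (ψ : ℝ → ℝ) := ψ.hasCompactSupport
  set J₁ : ℝ := ∫ r in Set.Ioi (0 : ℝ), r ^ ((n : ℝ) + d - 1) * ψ r with hJ₁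
  set J₂ : ℝ := ∫ r in Set.Ioi (0 : ℝ), r ^ ((n : ℝ) + d) * deriv ψ r with hJ₂
  have hc1 := continuous_rpow_mul hψ.continuous hψ0 ((n : ℝ) + d - 1)
  have hc2 := continuous_rpow_mul (hψ.continuous_deriv le_rfl) hψ0' ((n : ℝ) + d)
  have hi1 : Integrable fun r : ℝ => r ^ ((n : ℝ) + d - 1) * ψ r :=
    hc1.integrable_of_hasCompactSupport hcs.mul_left
  have hi2 : Integrable fun r : ℝ => r ^ ((n : ℝ) + d) * deriv ψ r :=
    hc2.integrable_of_hasCompactSupport hcs.deriv.mul_left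
  have hJ : J₂ = -((n + d) * J₁) := by
    have h1 := HasCompactSupport.integral_Ioi_deriv_eq
      (contDiff_rpow_mul hψ hψ0 ((n : ℝ) + d)) hcs.mul_left 0
    rw [hψ1 0 zero_le_one, mul_zero, neg_zero] at h1
    have h2 : ∫ r in Set.Ioi (0 : ℝ), deriv (fun r : ℝ => r ^ ((n : ℝ) + d) * ψ r) r =
        ∫ r in Set.Ioi (0 : ℝ), ((n + d) * (r ^ ((n : ℝ) + d - 1) * ψ r) +
          r ^ ((n : ℝ) + d) * deriv ψ r) := by
      refine setIntegral_congr_fun measurableSet_Ioi fun r hr => ?_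
      have hr0 : r ≠ 0 := ne_of_gt hr
      have := (Real.hasDerivAt_rpow_const (p := (n : ℝ) + d) (Or.inl hr0)).mul
        (hψ.differentiable one_ne_zero r).hasDerivAt
      exact this.deriv.trans (by ring)
    rw [h2, integral_add (hi1.integrableOn.const_mul _) hi2.integrableOn,
      integral_const_mul] at h1
    linarith
  -- Needed to cancel `J₁` at the end.
  have hJpos : 0 < J₁ := by
    have h1 : J₁ = ∫ r : ℝ, r ^ ((n : ℝ) + d - 1) * ψ r := by
      refine setIntegral_eq_integral_of_forall_compl_eq_zero fun r hr => ?_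
      rw [hψ1 r (le_trans (not_lt.1 hr) zero_le_one), mul_zero]
    rw [h1]
    refine hc1.integral_pos_of_hasCompactSupport_nonneg_nonzero hcs.mul_left (fun r => ?_)
      (x := 2) ?_
    · rcases le_or_gt r 1 with hr | hr
      · simp [hψ1 r hr]
      · exact mul_nonneg (Real.rpow_nonneg (by linarith) _) ψ.nonneg
    · have : ψ 2 = 1 := ψ.one_of_mem_closedBall (mem_closedBall_self (by norm_num [ψ]))
      rw [this, mul_one]
      exact (Real.rpow_pos_of_pos two_pos _).ne'
  -- the cut-off function
  set Φ : Euc n → ℝ := fun y => ψ ‖y‖ * F y with hΦ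
  have hΦd : ContDiff ℝ 1 Φ := by
    refine contDiff_iff_contDiffAt.2 fun y => ?_
    rcases eq_or_ne y 0 with rfl | hy
    · have : Φ =ᶠ[𝓝 0] fun _ => 0 := by
        filter_upwards [ball_mem_nhds (0 : Euc n) one_pos] with z hz
        simp only [hΦ]
        rw [hψ1 _ (by simpa using (mem_ball_zero_iff.1 hz).le), zero_mul]
      exact contDiffAt_const.congr_of_eventuallyEq this
    · exact (hψ.contDiffAt.comp y (contDiffAt_norm ℝ hy)).mul (hF y hy)
  have hΦc : HasCompactSupport Φ := by
    refine HasCompactSupport.intro (isCompact_closedBall (0 : Euc n) 3) fun y hy => ?_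
    rw [mem_closedBall_zero_iff, not_le] at hy
    simp only [hΦ]
    rw [hψ3 _ hy.le, zero_mul]
  have hzero := integral_fderiv_apply_eq_zero hΦd hΦc e
  rw [integral_polar] at hzero
  have hpt : ∀ z : Sph n × Set.Ioi (0 : ℝ), fderiv ℝ Φ ((z.2 : ℝ) • (z.1 : Euc n)) e =
      (F (z.1 : Euc n) * ⟪(z.1 : Euc n), e⟫) * ((z.2 : ℝ) ^ d * deriv ψ z.2) +
        fderiv ℝ F (z.1 : Euc n) e * ((z.2 : ℝ) ^ (d - 1) * ψ z.2) := by
    rintro ⟨x, ⟨r, hr⟩⟩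
    have hr' : (0 : ℝ) < r := hr
    have hx1 := norm_eq_one_of_mem x
    have hx0 := ne_zero_of_norm_eq_one hx1
    have hrx : r • (x : Euc n) ≠ 0 := smul_ne_zero hr'.ne' hx0
    have hnr : ‖r • (x : Euc n)‖ = r := by
      rw [norm_smul, hx1, mul_one, Real.norm_of_nonneg hr'.le]
    have h1 : HasFDerivAt (fun y : Euc n => ψ ‖y‖)
        (deriv ψ r • (r⁻¹ • innerSL ℝ (r • (x : Euc n)))) (r • (x : Euc n)) := by
      have h2 := hasFDerivAt_norm_euc hrx
      rw [hnr] at h2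
      have h3 : HasDerivAt ψ (deriv ψ r) ‖r • (x : Euc n)‖ := by
        rw [hnr]; exact (hψ.differentiable one_ne_zero r).hasDerivAt
      exact h3.comp_hasFDerivAt _ h2
    have h4 : fderiv ℝ Φ (r • (x : Euc n)) = _ :=
      (h1.mul ((hF _ hrx).differentiableAt one_ne_zero).hasFDerivAt).fderiv
    simp only [h4]
    rw [ fderiv_smul_of_homogeneous hhom hr' hx0, hhom r hr' _ hx0, hnr]
    simp [hr'.ne']
    ring
  simp only [hpt] at hzero
  have hr1 : ∀ r ∈ Set.Ioi (0 : ℝ), r ^ n * (r ^ d * deriv ψ r) =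
      r ^ ((n : ℝ) + d) * deriv ψ r := fun r hr => by
    rw [Real.rpow_add hr, Real.rpow_natCast]; ring
  have hr2 : ∀ r ∈ Set.Ioi (0 : ℝ), r ^ n * (r ^ (d - 1) * ψ r) =
      r ^ ((n : ℝ) + d - 1) * ψ r := fun r hr => by
    rw [add_sub_assoc, Real.rpow_add hr, Real.rpow_natCast]; ring
  have hK2 : ∫ r : Set.Ioi (0 : ℝ), (r : ℝ) ^ d * deriv ψ r ∂(Measure.volumeIoiPow n) = J₂ := by
    rw [integral_volumeIoiPow n fun r => r ^ d * deriv ψ r]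
    exact setIntegral_congr_fun measurableSet_Ioi hr1
  have hK1 : ∫ r : Set.Ioi (0 : ℝ), (r : ℝ) ^ (d - 1) * ψ r ∂(Measure.volumeIoiPow n) = J₁ := by
    rw [integral_volumeIoiPow n fun r => r ^ (d - 1) * ψ r]
    exact setIntegral_congr_fun measurableSet_Ioi hr2
  have hI2 : Integrable (fun r : Set.Ioi (0 : ℝ) => (r : ℝ) ^ d * deriv ψ r)
      (Measure.volumeIoiPow n) :=
    integrable_volumeIoiPow n (φ := fun r => r ^ d * deriv ψ r)
      (hi2.integrableOn.congr_fun (fun r hr => (hr1 r hr).symm) measurableSet_Ioi)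
  have hI1 : Integrable (fun r : Set.Ioi (0 : ℝ) => (r : ℝ) ^ (d - 1) * ψ r)
      (Measure.volumeIoiPow n) :=
    integrable_volumeIoiPow n (φ := fun r => r ^ (d - 1) * ψ r)
      (hi1.integrableOn.congr_fun (fun r hr => (hr2 r hr).symm) measurableSet_Ioi)
  have hFc : Continuous fun x : Sph n => F (x : Euc n) :=
    continuous_iff_continuousAt.2 fun x => ContinuousAt.comp (f := Subtype.val) (g := F)
      (hF _ (ne_zero_of_norm_eq_one (norm_eq_one_of_mem x))).continuousAt continuousAt_subtype_val
  have hF'c : Continuous fun x : Sph n => fderiv ℝ F (x : Euc n) e :=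
    continuous_iff_continuousAt.2 fun x =>
      ContinuousAt.comp (f := Subtype.val) (g := fun y => fderiv ℝ F y e)
      (((hF _ (ne_zero_of_norm_eq_one (norm_eq_one_of_mem x))).fderiv_right (m := 0)
        (by simp)).continuousAt.clm_apply continuousAt_const) continuousAt_subtype_val
  have hA : Integrable (fun x : Sph n => F (x : Euc n) * ⟪(x : Euc n), e⟫) (sphMeasure n) :=
    (hFc.mul (continuous_subtype_val.inner (𝕜 := ℝ) (continuous_const (y := e)))
      ).integrable_sphere _
  have hB := hF'c.integrable_sphere (sphMeasure n)
  rw [integral_add (hA.mul_prod hI2) (hB.mul_prod hI1),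
    integral_prod_mul (fun x : Sph n => F (x : Euc n) * ⟪(x : Euc n), e⟫)
      (fun r : Set.Ioi (0 : ℝ) => (r : ℝ) ^ d * deriv ψ r),
    integral_prod_mul (fun x : Sph n => fderiv ℝ F (x : Euc n) e)
      (fun r : Set.Ioi (0 : ℝ) => (r : ℝ) ^ (d - 1) * ψ r), hK1, hK2, hJ] at hzero
  refine mul_right_cancel₀ hJpos.ne' ?_
  linarith

end HomogeneousDivergence

/-! ### Integrals against the cone measure, and the translated body. -/

theorem integral_withDensity_sphere {n : ℕ} {ρ : Sph n → ℝ} (hρ : Continuous ρ)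
    (hρ0 : ∀ x, 0 ≤ ρ x) (g : Sph n → ℝ) :
    ∫ x, g x ∂((sphMeasure n).withDensity fun x => ENNReal.ofReal (ρ x)) =
      ∫ x, ρ x * g x ∂(sphMeasure n) := by
  rw [integral_withDensity_eq_integral_toReal_smul hρ.measurable.ennreal_ofReal
    (Eventually.of_forall fun x => ENNReal.ofReal_lt_top)]
  simp only [ENNReal.toReal_ofReal (hρ0 _), smul_eq_mul]

namespace IsSmoothStrictlyConvexBody

variable {n : ℕ} {K : Set (Euc n)}

theorem coneMeasure_eq (hK : IsSmoothStrictlyConvexBody K) :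
    coneMeasure K =
      (sphMeasure n).withDensity fun x => ENNReal.ofReal (coneDensity K (x : Euc n)) := by
  rw [coneMeasure]
  congr 1
  ext x
  rw [hK.coneDensity_eq_div (norm_eq_one_of_mem x)]

theorem isFiniteMeasure_coneMeasure (hK : IsSmoothStrictlyConvexBody K) :
    IsFiniteMeasure (coneMeasure K) := by
  rw [hK.coneMeasure_eq]
  exact isFiniteMeasure_withDensity_ofReal
    (hK.continuous_coneDensity_sphere.integrable_sphere _).2

theorem integral_coneMeasure (hK : IsSmoothStrictlyConvexBody K)
    (h0 : (0 : Euc n) ∈ interior K) (g : Sph n → ℝ) :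
    ∫ x, g x ∂(coneMeasure K) =
      ∫ x, coneDensity K (x : Euc n) * g x ∂(sphMeasure n) := by
  rw [hK.coneMeasure_eq]
  exact integral_withDensity_sphere hK.continuous_coneDensity_sphere
    (fun x => hK.coneDensity_nonneg h0 (norm_eq_one_of_mem x)) g

theorem integral_coneMeasure_one_pos (hK : IsSmoothStrictlyConvexBody K)
    (h0 : (0 : Euc n) ∈ interior K) : 0 < ∫ _x : Sph n, (1 : ℝ) ∂(coneMeasure K) := by
  rw [hK.integral_coneMeasure h0]
  simp only [mul_one]
  have h1 : 0 < volume K := Measure.measure_pos_of_nonempty_interior _ ⟨0, h0⟩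
  rw [hK.volume_eq h0, ENNReal.ofReal_pos] at h1
  exact (div_pos_iff_of_pos_right (by positivity)).1 h1

theorem invGaussMap_eq (hK : IsSmoothStrictlyConvexBody K) (x : Sph n) :
    invGaussMap K (x : Euc n) = gradient (supportFun K) (x : Euc n) := by
  have hx := norm_eq_one_of_mem x
  rw [invGaussMap, hK.sphGrad_supportFun (ne_zero_of_norm_eq_one hx), hx]
  simp

theorem integral_inner_gradient_coneCenter (hK : IsSmoothStrictlyConvexBody K)
    (h0 : (0 : Euc n) ∈ interior K) :
    ∫ x : Sph n, ⟪gradient (supportFun K) (x : Euc n), coneCenter K⟫ ∂(coneMeasure K) =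
      ‖coneCenter K‖ ^ 2 * ∫ _x : Sph n, (1 : ℝ) ∂(coneMeasure K) := by
  have := hK.isFiniteMeasure_coneMeasure
  have hV := (hK.integral_coneMeasure_one_pos h0).ne'
  set V := ∫ _x : Sph n, (1 : ℝ) ∂(coneMeasure K) with hVdef
  have hX : ∫ x : Sph n, gradient (supportFun K) (x : Euc n) ∂(coneMeasure K) =
      V • coneCenter K := by
    rw [coneCenter, ← hVdef, smul_inv_smul₀ hV]
    simp only [hK.invGaussMap_eq]
  have h1 := integral_inner (𝕜 := ℝ) (hK.continuous_gradient_sphere.integrable_sphere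
    (coneMeasure K)) (coneCenter K)
  simp only [real_inner_comm _ (coneCenter K)] at h1 ⊢
  rw [hX, real_inner_smul_left, real_inner_self_eq_norm_sq] at h1
  rw [h1, mul_comm]

theorem integral_stretchRate (hK : IsSmoothStrictlyConvexBody K)
    (h0 : (0 : Euc n) ∈ interior K) (c : Euc n) :
    (n + 1) * ∫ x : Sph n, stretchRate K c (x : Euc n) ∂(coneMeasure K) =
      ‖c‖ ^ 2 * ∫ _x : Sph n, (1 : ℝ) ∂(coneMeasure K) := by
  rw [hK.integral_coneMeasure h0, hK.integral_coneMeasure h0]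
  simpa using hK.integral_coneDensity_mul_stretchRate h0 c

theorem supportFun_centeredBody (hK : IsSmoothStrictlyConvexBody K) (y : Euc n) :
    supportFun (centeredBody K) y = supportFun K y - ⟪y, coneCenter K⟫ := by
  obtain ⟨q, hq, hqy⟩ := exists_supportFun_eq hK.isCompact hK.nonempty y
  rw [hqy, ← inner_sub_right]
  refine supportFun_eq_of_forall_le ⟨q, hq, rfl⟩ ?_
  rintro _ ⟨k, hk, rfl⟩
  have := inner_le_supportFun hK.isCompact y hk
  simp only [inner_sub_right]
  linarith

theorem sphGrad_supportFun_centeredBody (hK : IsSmoothStrictlyConvexBody K) (x : Sph n) :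
    sphGrad (supportFun (centeredBody K)) (x : Euc n) =
      (gradient (supportFun K) (x : Euc n) - coneCenter K) -
        (supportFun K (x : Euc n) - ⟪(x : Euc n), coneCenter K⟫) • (x : Euc n) := by
  have hx := norm_eq_one_of_mem x
  have hx0 := ne_zero_of_norm_eq_one hx
  have h : radialExt (supportFun (centeredBody K)) = fun z =>
      ‖z‖⁻¹ * (supportFun K z - innerSL ℝ (coneCenter K) z) := funext fun z => by
    rw [radialExt, hK.supportFun_centeredBody, supportFun_smul (inv_nonneg.2 (norm_nonneg z)),
      real_inner_smul_left, innerSL_apply_apply, real_inner_comm, mul_sub]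
  rw [sphGrad, h]
  refine gradient_eq_of_hasFDerivAt ((hasFDerivAt_norm_inv_euc hx0).mul
    ((hK.hasFDerivAt_supportFun hx0).sub
      (innerSL ℝ (coneCenter K)).hasFDerivAt)) fun v => ?_
  simp [inner_sub_left, real_inner_smul_right, hx, real_inner_comm]
  ring

/-- Pythagoras: the two spherical gradients are the tangential parts of `X` and `X - c`, whose
normal components are `h` and `h - ⟪x,c⟫`. -/
theorem norm_sq_sphGrad (hK : IsSmoothStrictlyConvexBody K) (x : Sph n) :
    ‖sphGrad (supportFun K) (x : Euc n)‖ ^ 2 =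
      ‖sphGrad (supportFun (centeredBody K)) (x : Euc n)‖ ^ 2 +
        (2 * ⟪gradient (supportFun K) (x : Euc n), coneCenter K⟫ - ‖coneCenter K‖ ^ 2 +
          (⟪(x : Euc n), coneCenter K⟫ ^ 2 -
            2 * (supportFun K (x : Euc n) * ⟪(x : Euc n), coneCenter K⟫))) := by
  have hx := norm_eq_one_of_mem x
  have hx0 := ne_zero_of_norm_eq_one hx
  have hXx := hK.inner_gradient hx0
  have aux : ∀ (a : Euc n) (s : ℝ), ⟪(x : Euc n), a⟫ = s →
      ‖a - s • (x : Euc n)‖ ^ 2 = ‖a‖ ^ 2 - s ^ 2 := by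
    intro a s hs
    rw [norm_sub_sq_real, real_inner_smul_right, real_inner_comm, hs, norm_smul, hx, mul_one,
      Real.norm_eq_abs, sq_abs]
    ring
  rw [hK.sphGrad_supportFun_centeredBody, hK.sphGrad_supportFun hx0, hx, inv_one, one_smul,
    one_pow, one_mul, aux _ _ hXx, aux _ _ (by rw [inner_sub_right, hXx]), norm_sub_sq_real]
  ring

theorem continuous_sphGrad_centeredBody (hK : IsSmoothStrictlyConvexBody K) :
    Continuous fun x : Sph n => sphGrad (supportFun (centeredBody K)) (x : Euc n) := by
  simp only [hK.sphGrad_supportFun_centeredBody]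
  exact (hK.continuous_gradient_sphere.sub continuous_const).sub
    ((hK.continuous_supportFun_sphere.sub (by fun_prop)).smul continuous_subtype_val)

/-! ### Moment identities when the cone measure has density `h^p`. -/

section PowerDensity

variable {p : ℝ}

theorem integral_coneMeasure_of_rpow (hK : IsSmoothStrictlyConvexBody K)
    (h0 : (0 : Euc n) ∈ interior K)
    (hV : coneMeasure K = (sphMeasure n).withDensity
      (fun x => ENNReal.ofReal (supportFun K (x : Euc n) ^ p))) (g : Sph n → ℝ) :
    ∫ x, g x ∂(coneMeasure K) =
      ∫ x, supportFun K (x : Euc n) ^ p * g x ∂(sphMeasure n) := by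
  rw [hV]
  refine integral_withDensity_sphere ?_
    (fun x => Real.rpow_nonneg (hK.supportFun_sphere_pos h0 x).le p) g
  exact hK.continuous_supportFun_sphere.rpow_const
    fun x => Or.inl (hK.supportFun_sphere_pos h0 x).ne'

theorem hasFDerivAt_supportFun_rpow (hK : IsSmoothStrictlyConvexBody K)
    (h0 : (0 : Euc n) ∈ interior K) (a : ℝ) {y : Euc n} (hy : y ≠ 0) :
    HasFDerivAt (fun z => supportFun K z ^ a)
      ((a * supportFun K y ^ (a - 1)) • innerSL ℝ (gradient (supportFun K) y)) y :=
  (hK.hasFDerivAt_supportFun hy).rpow_const (Or.inl (supportFun_pos hK.isCompact h0 hy).ne')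

theorem contDiffAt_supportFun_rpow (hK : IsSmoothStrictlyConvexBody K)
    (h0 : (0 : Euc n) ∈ interior K) (a : ℝ) {y : Euc n} (hy : y ≠ 0) :
    ContDiffAt ℝ 1 (fun z => supportFun K z ^ a) y :=
  ((hK.contDiffAt_supportFun hy).of_le (by simp)).rpow_const_of_ne
    (supportFun_pos hK.isCompact h0 hy).ne'

theorem supportFun_rpow_smul (hK : IsSmoothStrictlyConvexBody K)
    (h0 : (0 : Euc n) ∈ interior K) (a : ℝ) {t : ℝ} (ht : 0 < t) {y : Euc n} (hy : y ≠ 0) :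
    supportFun K (t • y) ^ a = t ^ a * supportFun K y ^ a := by
  rw [supportFun_smul ht.le, Real.mul_rpow ht.le (supportFun_pos hK.isCompact h0 hy).le]

/-- The spherical divergence identity for `h^(p+1)`, of degree `p + 1`. -/
theorem integral_inner_gradient_of_rpow (hK : IsSmoothStrictlyConvexBody K)
    (h0 : (0 : Euc n) ∈ interior K)
    (hV : coneMeasure K = (sphMeasure n).withDensity
      (fun x => ENNReal.ofReal (supportFun K (x : Euc n) ^ p))) (c : Euc n) :
    (p + 1) * ∫ x : Sph n, ⟪gradient (supportFun K) (x : Euc n), c⟫ ∂(coneMeasure K) =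
      (n + 1 + p) * ∫ x : Sph n, supportFun K (x : Euc n) * ⟪(x : Euc n), c⟫
        ∂(coneMeasure K) := by
  have h := integral_fderiv_sphere_of_homogeneous (d := p + 1)
    (fun y hy => hK.contDiffAt_supportFun_rpow h0 (p + 1) hy)
    (fun t ht y hy => hK.supportFun_rpow_smul h0 (p + 1) ht hy) c
  rw [hK.integral_coneMeasure_of_rpow h0 hV, hK.integral_coneMeasure_of_rpow h0 hV,
    ← integral_const_mul]
  have h1 : ∀ x : Sph n, fderiv ℝ (fun z => supportFun K z ^ (p + 1)) (x : Euc n) c =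
      (p + 1) * (supportFun K (x : Euc n) ^ p * ⟪gradient (supportFun K) (x : Euc n), c⟫) := by
    intro x
    rw [(hK.hasFDerivAt_supportFun_rpow h0 (p + 1)
      (ne_zero_of_norm_eq_one (norm_eq_one_of_mem x))).fderiv]
    simp [mul_assoc]
  have h2 : ∀ x : Sph n, supportFun K (x : Euc n) ^ (p + 1) * ⟪(x : Euc n), c⟫ =
      supportFun K (x : Euc n) ^ p * (supportFun K (x : Euc n) * ⟪(x : Euc n), c⟫) := by
    intro x
    rw [Real.rpow_add_one (hK.supportFun_sphere_pos h0 x).ne', mul_assoc]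
  simp only [h1, h2] at h
  rw [h]
  ring

/-- The same identity for `h^p ⟪y,c⟫`, again of degree `p + 1`; differentiating the factor `h^p` is
what produces the stretch rate. -/
theorem integral_inner_sq_of_rpow (hK : IsSmoothStrictlyConvexBody K)
    (h0 : (0 : Euc n) ∈ interior K)
    (hV : coneMeasure K = (sphMeasure n).withDensity
      (fun x => ENNReal.ofReal (supportFun K (x : Euc n) ^ p))) (c : Euc n) :
    p * ∫ x : Sph n, stretchRate K c (x : Euc n) ∂(coneMeasure K) +
        ‖c‖ ^ 2 * ∫ _x : Sph n, (1 : ℝ) ∂(coneMeasure K) =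
      (n + 1 + p) * ∫ x : Sph n, ⟪(x : Euc n), c⟫ ^ 2 ∂(coneMeasure K) := by
  have := hK.isFiniteMeasure_coneMeasure
  have hlin : ∀ y : Euc n, HasFDerivAt (fun z : Euc n => ⟪z, c⟫) (innerSL ℝ c) y := fun y =>
    (innerSL ℝ c).hasFDerivAt.congr_of_eventuallyEq
      (Eventually.of_forall fun z => by simp [real_inner_comm])
  have h := integral_fderiv_sphere_of_homogeneous (d := p + 1)
    (F := fun y => supportFun K y ^ p * ⟪y, c⟫)
    (fun y hy => (hK.contDiffAt_supportFun_rpow h0 p hy).mul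
      (contDiffAt_id.inner ℝ contDiffAt_const))
    (fun t ht y hy => by
      rw [hK.supportFun_rpow_smul h0 p ht hy, real_inner_smul_left, Real.rpow_add_one ht.ne']
      ring) c
  have h1 : ∀ x : Sph n, fderiv ℝ (fun y => supportFun K y ^ p * ⟪y, c⟫) (x : Euc n) c =
      supportFun K (x : Euc n) ^ p * (p * stretchRate K c (x : Euc n) + ‖c‖ ^ 2 * 1) := by
    intro x
    have hx0 := ne_zero_of_norm_eq_one (norm_eq_one_of_mem x)
    have hd : fderiv ℝ (fun y => supportFun K y ^ p * ⟪y, c⟫) (x : Euc n) = _ :=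
      ((hK.hasFDerivAt_supportFun_rpow h0 p hx0).mul (hlin x)).fderiv
    rw [hd, Real.rpow_sub_one (hK.supportFun_sphere_pos h0 x).ne', stretchRate]
    simp
    ring
  have h2 : ∀ x : Sph n, supportFun K (x : Euc n) ^ p * ⟪(x : Euc n), c⟫ * ⟪(x : Euc n), c⟫ =
      supportFun K (x : Euc n) ^ p * ⟪(x : Euc n), c⟫ ^ 2 := fun x => by ring
  simp only [h1, h2] at h
  rw [← hK.integral_coneMeasure_of_rpow h0 hV, ← hK.integral_coneMeasure_of_rpow h0 hV,
    integral_add, integral_const_mul, integral_const_mul] at h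
  · rw [h]; ring
  · exact ((hK.continuous_stretchRate_sphere h0 c).const_mul p).integrable_sphere _
  · exact integrable_const _

end PowerDensity

end IsSmoothStrictlyConvexBody

/-! ### Assembling the identity. -/

theorem mainTheorem6 (n : ℕ) (hn : 1 ≤ n) (K : Set (Euc n))
    (hK : IsSmoothStrictlyConvexBody K) (h0 : (0 : Euc n) ∈ interior K)
    (p : ℝ) (hp : -(n : ℝ) - 1 < p)
    (hV : coneMeasure K =
      (sphMeasure n).withDensity
        (fun x => ENNReal.ofReal (supportFun K (x : Euc n) ^ p))) :
    ∫ x : Sph n, ‖sphGrad (supportFun K) (x : Euc n)‖ ^ 2 ∂(coneMeasure K) =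
      ∫ x : Sph n, ‖sphGrad (supportFun (centeredBody K)) (x : Euc n)‖ ^ 2 ∂(coneMeasure K) +
        (n : ℝ) * ((n : ℝ) + 1 - p) * ‖coneCenter K‖ ^ 2 / (((n : ℝ) + 1) * ((n : ℝ) + 1 + p)) *
          ∫ _x : Sph n, (1 : ℝ) ∂(coneMeasure K) := by
  have := hK.isFiniteMeasure_coneMeasure
  set μ := coneMeasure K with hμ
  set c := coneCenter K with hc
  have e1 := hK.integral_inner_gradient_coneCenter h0
  have e2 := hK.integral_inner_gradient_of_rpow h0 hV c
  have e3 := hK.integral_stretchRate h0 c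
  have e4 := hK.integral_inner_sq_of_rpow h0 hV c
  rw [← hμ, ← hc] at e1
  rw [← hμ] at e2 e3 e4
  have c1 : Continuous fun x : Sph n => ⟪gradient (supportFun K) (x : Euc n), c⟫ :=
    hK.continuous_gradient_sphere.inner continuous_const
  have c2 : Continuous fun x : Sph n => ⟪(x : Euc n), c⟫ := by fun_prop
  have i0 : Integrable (fun x : Sph n =>
      ‖sphGrad (supportFun (centeredBody K)) (x : Euc n)‖ ^ 2) μ :=
    (hK.continuous_sphGrad_centeredBody.norm.pow 2).integrable_sphere μ
  have i1 : Integrable (fun x : Sph n => 2 * ⟪gradient (supportFun K) (x : Euc n), c⟫) μ :=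
    (c1.const_mul 2).integrable_sphere μ
  have i2 : Integrable (fun x : Sph n => ⟪(x : Euc n), c⟫ ^ 2) μ := (c2.pow 2).integrable_sphere μ
  have i3 : Integrable (fun x : Sph n =>
      2 * (supportFun K (x : Euc n) * ⟪(x : Euc n), c⟫)) μ :=
    ((hK.continuous_supportFun_sphere.mul c2).const_mul 2).integrable_sphere μ
  have i4 : Integrable (fun _ : Sph n => ‖c‖ ^ 2) μ := integrable_const _
  have i5 : Integrable (fun x : Sph n =>
      2 * ⟪gradient (supportFun K) (x : Euc n), c⟫ - ‖c‖ ^ 2) μ := i1.sub i4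
  have i6 : Integrable (fun x : Sph n => ⟪(x : Euc n), c⟫ ^ 2 -
      2 * (supportFun K (x : Euc n) * ⟪(x : Euc n), c⟫)) μ := i2.sub i3
  have i7 : Integrable (fun x : Sph n =>
      2 * ⟪gradient (supportFun K) (x : Euc n), c⟫ - ‖c‖ ^ 2 + (⟪(x : Euc n), c⟫ ^ 2 -
        2 * (supportFun K (x : Euc n) * ⟪(x : Euc n), c⟫))) μ := i5.add i6
  have hconst : ∫ _x : Sph n, ‖c‖ ^ 2 ∂μ = ‖c‖ ^ 2 * ∫ _x : Sph n, (1 : ℝ) ∂μ := by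
    rw [← integral_const_mul]; simp
  simp only [hK.norm_sq_sphGrad]
  rw [← hc, integral_add i0 i7, integral_add i5 i6,
    integral_sub i1 i4, integral_sub i2 i3, integral_const_mul, integral_const_mul, hconst, e1]
  rw [e1] at e2
  set V := ∫ _x : Sph n, (1 : ℝ) ∂μ
  set Q := ∫ x : Sph n, supportFun K (x : Euc n) * ⟪(x : Euc n), c⟫ ∂μ
  set I := ∫ x : Sph n, ⟪(x : Euc n), c⟫ ^ 2 ∂μ
  set S := ∫ x : Sph n, stretchRate K c (x : Euc n) ∂μ
  have hn1 : (n : ℝ) + 1 ≠ 0 := by positivity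
  -- The bound on `p` enters here, to solve the two moment identities for `Q` and `I`.
  have hnp : (n : ℝ) + 1 + p ≠ 0 := by linarith
  have hQ : Q = (p + 1) * (‖c‖ ^ 2 * V) / (n + 1 + p) := by
    rw [eq_div_iff hnp, e2]; ring
  -- With this value of `S`, the factor `n + 1 + p` cancels from the equation for `I`, so `I` does
  -- not depend on `p` explicitly.
  have hS : S = ‖c‖ ^ 2 * V / (n + 1) := by
    rw [eq_div_iff hn1, ← e3]; ring
  have hI : I = ‖c‖ ^ 2 * V / (n + 1) := by
    rw [eq_div_iff hn1]
    refine mul_left_cancel₀ hnp ?_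
    rw [hS] at e4
    field_simp at e4
    linarith
  rw [hQ, hI]
  field_simp
  ring
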